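/- Let $d\in\mathbb N$, let $\mathcal X=\mathbb R^d$ or $\mathcal X=\mathbb Z^d$, and let $\mathcal H=L^2(\mathcal X)$ (Lebesgue measure, respectively counting measure). Let $V:\mathcal X\to\mathbb R$ be measurable and let $H=-\Delta+V$, with domain $D(\Delta)\cap D(V)$, where $D(V)=\{\psi\in\mathcal H: V\psi\in\mathcal H\}$ and $D(\Delta)$ is the Sobolev space $H^2(\mathbb R^d)$ if $\mathcal X=\mathbb R^d$, and $D(\Delta)=\ell^2(\mathbb Z^d)$, $(\Delta\psi)(n)=\sum_{j=1}^d\big(\psi(n+e_j)+\psi(n-e_j)-2\psi(n)\big)$ if $\mathcal X=\mathbb Z^d$. Assume that $H$ is self-adjoint (as is the case, for example, for every bounded $V$). Let $Q:\mathcal H\to\mathcal H^d$, $Q\psi=(q_1\psi,\dots,q_d\psi)$, be the position operator, where $q_1,\dots,q_d$ are the coordinate functions on $\mathcal X$ and $D(Q)=\{\psi\in\mathcal H: q_j\psi\in\mathcal H \text{ for all } j\}$, and let $Q(t)=e^{itH}Qe^{-itH}$, where $e^{itH}$ acts componentwise on $\mathcal H^d$. A state $\psi\in\mathcal H$ exhibits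 ballistic transport in the strong sense if $e^{-itH}\psi\in D(Q)$ for all large $t$ and there is $P_\psi\in\mathcal H^d$, $P_\psi\neq0$, with $\frac{1}{t}Q(t)\psi\to P_\psi$ in $\mathcal H^d$ as $t\to\infty$. Let $\mathcal H_{pp}$ be the pure point subspace of $H$, that is, the closed linear span of the eigenvectors of $H$. Suppose that every nonzero $\psi\in D(Q)\cap D(H)$ exhibits ballistic transport in the strong sense. Then $$\mathcal H_{pp}\subset\{0\}\cup(\mathcal H\setminus D(Q)).$$ In other words, no nonzero $\psi\in\mathcal H_{pp}$ lies in $D(Q)$. -/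

import Mathlib

open MeasureTheory Filter Topology
open scoped ENNReal Laplacian SchwartzMap

noncomputable section

namespace BallisticTransport

/-! ### Quantum dynamics on an abstract Hilbert space -/

section Dynamics

variable {𝓗 : Type*} [NormedAddCommGroup 𝓗] [InnerProductSpace ℂ 𝓗]

/-- `U` is the unitary group `t ↦ e^{-itH}`: a strongly continuous one-parameter group of unitary
operators whose infinitesimal generator is exactly `-iH` (so `i ∂ₜ U(t)ψ = H U(t)ψ`, `U(0)ψ = ψ`).
For self-adjoint `H` there is exactly one such group (Stone's theorem). -/
structure IsPropagator (H : 𝓗 →ₗ.[ℂ] 𝓗) (U : ℝ → 𝓗 ≃ₗᵢ[ℂ] 𝓗) : Prop where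
  map_add : ∀ (s t : ℝ) (ψ : 𝓗), U (s + t) ψ = U s (U t ψ)
  continuous : ∀ ψ : 𝓗, Continuous fun t : ℝ => U t ψ
  hasDerivAt_iff : ∀ ψ φ : 𝓗, HasDerivAt (fun t : ℝ => U t ψ) φ 0 ↔
    ∃ h : ψ ∈ H.domain, φ = -(Complex.I • H ⟨ψ, h⟩)

open Classical in
/-- The propagator `e^{-itH}`. (The default value is never attained for self-adjoint `H`.) -/
def propagator (H : 𝓗 →ₗ.[ℂ] 𝓗) : ℝ → 𝓗 ≃ₗᵢ[ℂ] 𝓗 :=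
  if h : ∃ U, IsPropagator H U then h.choose else fun _ => LinearIsometryEquiv.refl ℂ 𝓗

/-- The pure point subspace of `H`: the closed linear span of all eigenvectors of `H`. -/
def purePointSubspace (H : 𝓗 →ₗ.[ℂ] 𝓗) : Submodule ℂ 𝓗 :=
  (Submodule.span ℂ
    {φ : 𝓗 | ∃ (E : ℝ) (h : φ ∈ H.domain), H ⟨φ, h⟩ = (E : ℂ) • φ}).topologicalClosure

variable {d : ℕ}

/-- The Heisenberg evolution `Q(t) = e^{itH} Q e^{-itH}` of an operator `Q : 𝓗 → 𝓗^d`, where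
`e^{itH}` acts on `𝓗^d` componentwise; its domain is `{ψ | e^{-itH} ψ ∈ D(Q)}`. -/
def heisenberg (H : 𝓗 →ₗ.[ℂ] 𝓗) (Q : 𝓗 →ₗ.[ℂ] PiLp 2 (fun _ : Fin d => 𝓗)) (t : ℝ) :
    𝓗 →ₗ.[ℂ] PiLp 2 (fun _ : Fin d => 𝓗) where
  domain := Q.domain.comap (propagator H t).toLinearEquiv.toLinearMap
  toFun :=
    { toFun := fun ψ => WithLp.toLp 2 fun j => propagator H (-t) (Q ⟨propagator H t ψ, ψ.2⟩ j)
      map_add' := by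
        intro ψ φ
        have h : (⟨propagator H t ↑(ψ + φ), (ψ + φ).2⟩ : Q.domain) =
            ⟨propagator H t ψ, ψ.2⟩ + ⟨propagator H t φ, φ.2⟩ :=
          Subtype.ext (map_add (propagator H t) (ψ : 𝓗) φ)
        ext1 j
        simp only [h, LinearPMap.map_add, PiLp.add_apply, map_add]
      map_smul' := by
        intro c ψ
        have h : (⟨propagator H t ↑(c • ψ), (c • ψ).2⟩ : Q.domain) =
            c • ⟨propagator H t ψ, ψ.2⟩ :=
          Subtype.ext (map_smul (propagator H t) c (ψ : 𝓗))
        ext1 j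
        simp only [h, LinearPMap.map_smul, PiLp.smul_apply, map_smul, RingHom.id_apply] }

/-- `ψ` exhibits strong ballistic transport: `Q(t)ψ / t` is defined for all large `t` and converges
in `𝓗^d`, as `t → ∞`, to an asymptotic velocity `P ≠ 0`. -/
def StrongBallisticTransport (H : 𝓗 →ₗ.[ℂ] 𝓗) (Q : 𝓗 →ₗ.[ℂ] PiLp 2 (fun _ : Fin d => 𝓗))
    (ψ : 𝓗) : Prop :=
  ∃ P : PiLp 2 (fun _ : Fin d => 𝓗), P ≠ 0 ∧
    ∃ f : ℝ → PiLp 2 (fun _ : Fin d => 𝓗),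
      (∀ᶠ t in atTop, (ψ, f t) ∈ (heisenberg H Q t).graph) ∧
      Tendsto (fun t : ℝ => ((t : ℂ)⁻¹) • f t) atTop (𝓝 P)

end Dynamics

/-! ### Multiplication operators and the position operator on `L²(X, μ)` -/

section Multiplication

variable {X : Type*} [MeasurableSpace X]

/-- Multiplication by a real function `f` on its maximal domain `{ψ ∈ L² | f ψ ∈ L²}`. -/
def mulOp (μ : Measure X) (f : X → ℝ) : Lp ℂ 2 μ →ₗ.[ℂ] Lp ℂ 2 μ where
  domain :=
    { carrier := {ψ | MemLp (fun x => (f x : ℂ) * ψ x) 2 μ}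
      add_mem' := by
        intro ψ φ hψ hφ
        refine MemLp.ae_eq ?_ (MemLp.add hψ hφ)
        filter_upwards [Lp.coeFn_add ψ φ] with x hx
        simp only [hx, Pi.add_apply, mul_add]
      zero_mem' := by
        refine MemLp.ae_eq ?_ (MemLp.zero (ε := ℂ) (p := 2) (μ := μ))
        filter_upwards [Lp.coeFn_zero ℂ 2 μ] with x hx
        simp only [hx, Pi.zero_apply, mul_zero]
      smul_mem' := by
        intro c ψ hψ
        refine MemLp.ae_eq ?_ (MemLp.const_smul hψ c)
        filter_upwards [Lp.coeFn_smul c ψ] with x hx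
        simp only [hx, Pi.smul_apply, smul_eq_mul, mul_left_comm] }
  toFun :=
    { toFun := fun ψ => MemLp.toLp (fun x => (f x : ℂ) * (ψ : Lp ℂ 2 μ) x) ψ.2
      map_add' := by
        intro ψ φ
        rw [← MemLp.toLp_add]
        refine MemLp.toLp_congr _ _ ?_
        filter_upwards [Lp.coeFn_add (ψ : Lp ℂ 2 μ) (φ : Lp ℂ 2 μ)] with x hx
        rw [Submodule.coe_add]
        simp only [hx, Pi.add_apply, mul_add]
      map_smul' := by
        intro c ψ
        rw [RingHom.id_apply, ← MemLp.toLp_const_smul]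
        refine MemLp.toLp_congr _ _ ?_
        filter_upwards [Lp.coeFn_smul c (ψ : Lp ℂ 2 μ)] with x hx
        rw [Submodule.coe_smul]
        simp only [hx, Pi.smul_apply, smul_eq_mul, mul_left_comm] }

variable {d : ℕ}

/-- The position operator `Qψ = (q₁ψ, …, q_dψ)` with coordinate functions `q j`, on the domain
`{ψ ∈ L² | q j ψ ∈ L² for all j}`, that is, `‖Qψ‖ < ∞`. -/
def positionOp (μ : Measure X) (q : Fin d → X → ℝ) :
    Lp ℂ 2 μ →ₗ.[ℂ] PiLp 2 (fun _ : Fin d => Lp ℂ 2 μ) where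
  domain := ⨅ j, (mulOp μ (q j)).domain
  toFun :=
    { toFun := fun ψ => WithLp.toLp 2 fun j =>
        mulOp μ (q j) ⟨ψ, (Submodule.mem_iInf _).1 ψ.2 j⟩
      map_add' := by
        intro ψ φ
        ext1 j
        exact (mulOp μ (q j)).map_add ⟨ψ, (Submodule.mem_iInf _).1 ψ.2 j⟩
          ⟨φ, (Submodule.mem_iInf _).1 φ.2 j⟩
      map_smul' := by
        intro c ψ
        ext1 j
        exact (mulOp μ (q j)).map_smul c ⟨ψ, (Submodule.mem_iInf _).1 ψ.2 j⟩ }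

end Multiplication

/-! ### The continuum `X = ℝ^d` -/

section Continuum

variable (d : ℕ)

/-- `L²(ℝ^d)` with Lebesgue measure. -/
abbrev L2R : Type := Lp ℂ 2 (volume : Measure (EuclideanSpace ℝ (Fin d)))

/-- The Sobolev space `H²(ℝ^d)` as a subspace of `L²(ℝ^d)`. -/
def sobolevH2 : Submodule ℂ (L2R d) where
  carrier := {ψ | TemperedDistribution.MemSobolev 2 2 (Lp.toTemperedDistribution ψ)}
  add_mem' := by
    intro ψ φ hψ hφ
    have h := TemperedDistribution.MemSobolev.add hψ hφ
    simpa only [Set.mem_ofPred_eq, ← Lp.toTemperedDistributionCLM_apply, ← map_add] using h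
  zero_mem' := by
    have h := TemperedDistribution.memSobolev_fun_zero (EuclideanSpace ℝ (Fin d)) ℂ 2 2
    simpa only [Set.mem_ofPred_eq, ← Lp.toTemperedDistributionCLM_apply, map_zero] using h
  smul_mem' := by
    intro c ψ hψ
    have h := TemperedDistribution.MemSobolev.smul c hψ
    simpa only [Set.mem_ofPred_eq, ← Lp.toTemperedDistributionCLM_apply, ← map_smul] using h

variable {d}

theorem exists_laplacian_eq (ψ : sobolevH2 d) :
    ∃ g : L2R d, Lp.toTemperedDistribution g =
      Δ (Lp.toTemperedDistribution (ψ : L2R d)) := by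
  have h := TemperedDistribution.MemSobolev.laplacian ψ.2
  rw [sub_self, TemperedDistribution.memSobolev_zero_iff] at h
  exact h.imp fun _ => Eq.symm

theorem toTemperedDistribution_injective :
    Function.Injective (fun g : L2R d => Lp.toTemperedDistribution g) := by
  have h := Lp.ker_toTemperedDistributionCLM_eq_bot (E := EuclideanSpace ℝ (Fin d)) (F := ℂ)
    (μ := volume) (p := 2)
  exact LinearMap.ker_eq_bot.1 h

variable (d)

/-- The Laplacian on `L²(ℝ^d)` with domain `H²(ℝ^d)`: for `ψ ∈ H²`, `Δψ` is the `L²` function that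
represents the distributional Laplacian of `ψ`. -/
def laplacianR : L2R d →ₗ.[ℂ] L2R d where
  domain := sobolevH2 d
  toFun :=
    { toFun := fun ψ => (exists_laplacian_eq ψ).choose
      map_add' := by
        intro ψ φ
        apply toTemperedDistribution_injective
        have h := (exists_laplacian_eq (ψ + φ)).choose_spec
        have h₁ := (exists_laplacian_eq ψ).choose_spec
        have h₂ := (exists_laplacian_eq φ).choose_spec
        simp only [← Lp.toTemperedDistributionCLM_apply,
          ← TemperedDistribution.laplacianCLM_apply] at h h₁ h₂ ⊢
        rw [h, map_add, h₁, h₂, Submodule.coe_add, map_add, map_add]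
      map_smul' := by
        intro c ψ
        apply toTemperedDistribution_injective
        have h := (exists_laplacian_eq (c • ψ)).choose_spec
        have h₁ := (exists_laplacian_eq ψ).choose_spec
        simp only [← Lp.toTemperedDistributionCLM_apply,
          ← TemperedDistribution.laplacianCLM_apply] at h h₁ ⊢
        rw [h, RingHom.id_apply, map_smul, h₁, Submodule.coe_smul, map_smul, map_smul] }

/-- The Schrödinger operator `-Δ + V` on `L²(ℝ^d)` with domain `H²(ℝ^d) ∩ D(V)`; this is `H²(ℝ^d)`
when `V` is bounded or, more generally, relatively bounded with respect to `-Δ`. -/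
def hamiltonianR (V : EuclideanSpace ℝ (Fin d) → ℝ) : L2R d →ₗ.[ℂ] L2R d :=
  -laplacianR d + mulOp volume V

/-- The position operator on `L²(ℝ^d)`. -/
def positionR : L2R d →ₗ.[ℂ] PiLp 2 (fun _ : Fin d => L2R d) :=
  positionOp volume fun j x => x j

end Continuum

/-! ### The lattice `X = ℤ^d` -/

section Lattice

variable (d : ℕ)

/-- `ℓ²(ℤ^d)`, that is, `L²` of the counting measure on `ℤ^d`. -/
abbrev L2Z : Type := Lp ℂ 2 (Measure.count : Measure (Fin d → ℤ))

variable {d}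

/-- The translation `(Sₘψ)(n) = ψ(n + m)` on `ℓ²(ℤ^d)`. -/
def shiftZ (m : Fin d → ℤ) : L2Z d →ₗ[ℂ] L2Z d :=
  Lp.compMeasurePreservingₗ ℂ (fun n : Fin d → ℤ => n + m)
    (measurePreserving_add_right (Measure.count : Measure (Fin d → ℤ)) m)

variable (d)

/-- The discrete Laplacian `(Δψ)(n) = ∑ⱼ (ψ(n + eⱼ) + ψ(n - eⱼ) - 2ψ(n))`, defined on all of
`ℓ²(ℤ^d)`. -/
def laplacianZ : L2Z d →ₗ.[ℂ] L2Z d :=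
  (∑ j : Fin d, (shiftZ (Pi.single j 1) + shiftZ (-Pi.single j 1) -
    (2 : ℂ) • LinearMap.id)).toPMap ⊤

/-- The discrete Schrödinger operator `-Δ + V` on `ℓ²(ℤ^d)` with domain `D(V)`; this is all of
`ℓ²(ℤ^d)` when `V` is bounded. -/
def hamiltonianZ (V : (Fin d → ℤ) → ℝ) : L2Z d →ₗ.[ℂ] L2Z d :=
  -laplacianZ d + mulOp Measure.count V

/-- The position operator on `ℓ²(ℤ^d)`. -/
def positionZ : L2Z d →ₗ.[ℂ] PiLp 2 (fun _ : Fin d => L2Z d) :=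
  positionOp Measure.count fun j n => (n j : ℝ)

end Lattice

end BallisticTransport

end

/-! Let `ψ` be a nonzero vector of the pure point subspace with `ψ ∈ D(Q)`. It need not lie in
`D(H)`, so it is replaced by `x = R ψ` with `R = (H - i)⁻¹`. This `x` is nonzero and lies in `D(H) ∩
D(Q)`, so it has a nonzero asymptotic velocity by hypothesis. The contradiction is that every
component of that velocity vanishes.

Each coordinate `q` is regularized by the bounded operators `G n = (e^{iεq} - 1)/(iε)`, `ε =
1/(n+1)`. They commute with `V`, and `[H, G n]` converges strongly on `D(H)` because `[-Δ, e^{iεq}]`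
is of first order in `ε` (`regularizes_hamiltonianR`, `regularizes_hamiltonianZ`). Hence the bounded
operators `T n = [H, G n] R` converge strongly and are uniformly bounded. An eigenvector only
acquires a phase under `e^{-itH}`, so on the pure point subspace `T n` is Cauchy uniformly along
whole trajectories (`IsPropagator.uniform_cauchy`).

Since `R` commutes with the evolution, the Heisenberg evolution of `G n - G m` on `x` therefore has
speed at most `η` for all `n ≥ m`, if `m` is large. Letting `n → ∞` bounds the evolution of `q - G
m` in the same way, while the bounded `G m` contributes only `O(1)`. So `‖q(t) x‖ ≤ η t + K` for
every `η > 0`, with `K` depending on `η`, and the velocity is zero (`Regularizes.velocity_eq_zero`).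

That `R` preserves `D(q)` comes from the same commutators (`Regularizes.resolvent_mem_domain`). The
existence of `e^{-itH}` (`exists_isPropagator`) is proved by approximating `H` by bounded functions
of it. -/

noncomputable section

namespace BallisticTransport

/-! ### Resolvents of self-adjoint operators -/

section Abstract

variable {𝓗 : Type*} [NormedAddCommGroup 𝓗] [InnerProductSpace ℂ 𝓗]

/-- `R` is the resolvent `(H - z)⁻¹`, as an everywhere defined bounded operator. -/
structure IsResolvent (H : 𝓗 →ₗ.[ℂ] 𝓗) (z : ℂ) (R : 𝓗 →L[ℂ] 𝓗) : Prop where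
  mem_domain : ∀ y, R y ∈ H.domain
  apply_right : ∀ y, H ⟨R y, mem_domain y⟩ = y + z • R y
  apply_left : ∀ x : H.domain, R (H x - z • (x : 𝓗)) = x

theorem IsResolvent.ne_zero {H : 𝓗 →ₗ.[ℂ] 𝓗} {z : ℂ} {R : 𝓗 →L[ℂ] 𝓗} (hR : IsResolvent H z R)
    {y : 𝓗} (hy : y ≠ 0) : R y ≠ 0 := by
  intro h
  have h1 := hR.apply_right y
  have h2 : (⟨R y, hR.mem_domain y⟩ : H.domain) = 0 := Subtype.ext h
  rw [h2, H.map_zero, h, smul_zero, add_zero] at h1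
  exact hy h1.symm

theorem IsResolvent.apply_map {z : ℂ} {R : 𝓗 →L[ℂ] 𝓗} (hR : IsResolvent H z R) (x : H.domain) :
    R (H x) = x + z • R x := by
  have h := hR.apply_left x
  rwa [map_sub, map_smul, sub_eq_iff_eq_add] at h

/-- Evaluating `R H S y` in two ways gives `(H - w) R S y = R y`; then `S` is applied to both sides.
-/
theorem IsResolvent.commute {z w : ℂ} {R S : 𝓗 →L[ℂ] 𝓗} (hR : IsResolvent H z R)
    (hS : IsResolvent H w S) : Commute R S := by
  refine ContinuousLinearMap.ext fun y => ?_
  have h := hS.apply_left ⟨R (S y), hR.mem_domain _⟩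
  have h1 := hR.apply_map ⟨S y, hS.mem_domain y⟩
  rw [hS.apply_right, map_add, map_smul] at h1
  dsimp only at h1 h
  rw [hR.apply_right, ← h1, add_sub_cancel_right] at h
  exact h.symm

section SelfAdjoint

variable [CompleteSpace 𝓗] {H : 𝓗 →ₗ.[ℂ] 𝓗}

theorem inner_apply_left_eq (hH : IsSelfAdjoint H) (x y : H.domain) :
    inner ℂ (H x) (y : 𝓗) = inner ℂ (x : 𝓗) (H y) := by
  have h := LinearPMap.adjoint_isFormalAdjoint hH.dense_domain
  rw [LinearPMap.isSelfAdjoint_def.1 hH] at h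
  exact h x y

/-- The identity places `(y, w)` in the graph of the adjoint, which is the graph of `H`. Both the
surjectivity of `H - z` and the exact domain of the generator in Stone's theorem rest on this. -/
theorem mem_domain_of_forall_inner (hH : IsSelfAdjoint H) {y w : 𝓗}
    (h : ∀ x : H.domain, inner ℂ w (x : 𝓗) = inner ℂ y (H x)) :
    ∃ hy : y ∈ H.domain, H ⟨y, hy⟩ = w := by
  have hA := LinearPMap.isSelfAdjoint_def.1 hH
  have hg : (y, w) ∈ H.graph := by
    rw [← hA, LinearPMap.adjoint_graph_eq_graph_adjoint hH.dense_domain,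
      Submodule.mem_adjoint_iff]
    intro a b hab
    obtain ⟨x, rfl, rfl⟩ := (LinearPMap.mem_graph_iff H).1 hab
    rw [sub_eq_zero, ← inner_conj_symm, ← h x, inner_conj_symm]
  obtain ⟨x, hx, hx'⟩ := (LinearPMap.mem_graph_iff H).1 hg
  dsimp only at hx hx'
  subst hx
  exact ⟨x.2, hx'⟩

/-- The cross term drops out because `⟨Hx, x⟩` is real and the shift is purely imaginary. -/
theorem norm_sub_smul_sq (hH : IsSelfAdjoint H) (l : ℝ) (x : H.domain) :
    ‖H x - ((l : ℂ) * Complex.I) • (x : 𝓗)‖ ^ 2 = ‖H x‖ ^ 2 + l ^ 2 * ‖(x : 𝓗)‖ ^ 2 := by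
  have h1 : (inner ℂ (H x) (x : 𝓗)).im = 0 := by
    rw [← Complex.conj_eq_iff_im, inner_conj_symm, inner_apply_left_eq hH]
  rw [@norm_sub_sq ℂ, inner_smul_right, norm_smul]
  simp [h1, mul_pow]

theorem abs_mul_norm_le (hH : IsSelfAdjoint H) (l : ℝ) (x : H.domain) :
    |l| * ‖(x : 𝓗)‖ ≤ ‖H x - ((l : ℂ) * Complex.I) • (x : 𝓗)‖ := by
  refine le_of_sq_le_sq ?_ (norm_nonneg _)
  rw [norm_sub_smul_sq hH, mul_pow, sq_abs]
  nlinarith [sq_nonneg ‖H x‖]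

/-- A self-adjoint operator has all nonreal imaginary points in its resolvent set. -/
theorem exists_isResolvent (hH : IsSelfAdjoint H) {l : ℝ} (hl : l ≠ 0) :
    ∃ R : 𝓗 →L[ℂ] 𝓗, IsResolvent H ((l : ℂ) * Complex.I) R ∧ ∀ y, |l| * ‖R y‖ ≤ ‖y‖ := by
  set z : ℂ := (l : ℂ) * Complex.I with hz
  have hl' : 0 < |l| := abs_pos.2 hl
  let S : H.domain →ₗ[ℂ] 𝓗 := H.toFun - z • H.domain.subtype
  have hS : ∀ x : H.domain, S x = H x - z • (x : 𝓗) := fun _ => rfl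
  have hbd : ∀ x : H.domain, |l| * ‖(x : 𝓗)‖ ≤ ‖S x‖ := abs_mul_norm_le hH l
  have hinj : Function.Injective S := by
    rw [← LinearMap.ker_eq_bot, LinearMap.ker_eq_bot']
    intro x hx
    have := hbd x
    rw [hx, norm_zero] at this
    have h0 : ‖(x : 𝓗)‖ = 0 := by nlinarith [norm_nonneg (x : 𝓗)]
    exact Subtype.ext (norm_eq_zero.1 h0)
  -- The lower bound `hbd` makes preimages of a convergent sequence Cauchy, and closedness of `H`
  -- identifies the image of their limit.
  have hclosed : IsClosed (S.range : Set 𝓗) := by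
    refine IsSeqClosed.isClosed fun u y hu huy => ?_
    choose x hx using hu
    have hcx : CauchySeq fun n => (x n : 𝓗) := by
      rw [Metric.cauchySeq_iff']
      intro ε hε
      obtain ⟨N, hN⟩ := Metric.cauchySeq_iff'.1 huy.cauchySeq (|l| * ε) (by positivity)
      refine ⟨N, fun n hn => ?_⟩
      have h1 := hN n hn
      have h2 := hbd (x n - x N)
      rw [map_sub, hx, hx, Submodule.coe_sub] at h2
      rw [dist_eq_norm] at h1 ⊢
      exact lt_of_mul_lt_mul_left (h2.trans_lt h1) hl'.le
    obtain ⟨x₀, hx₀⟩ := cauchySeq_tendsto_of_complete hcx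
    have hHx : Tendsto (fun n => H (x n)) atTop (𝓝 (y + z • x₀)) := by
      refine (huy.add (hx₀.const_smul z)).congr fun n => ?_
      rw [← hx, hS, sub_add_cancel]
    have hg : (x₀, y + z • x₀) ∈ H.graph :=
      IsClosed.mem_of_tendsto (f := fun n => ((x n : 𝓗), H (x n))) hH.isClosed
        (hx₀.prodMk_nhds hHx) (Eventually.of_forall fun n => H.mem_graph (x n))
    obtain ⟨x', h1, h2⟩ := (LinearPMap.mem_graph_iff H).1 hg
    dsimp only at h1 h2
    exact ⟨x', by rw [hS, h2, h1, add_sub_cancel_right]⟩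
  have htop : S.range = ⊤ := by
    have : CompleteSpace S.range := hclosed.completeSpace_coe
    -- A vector orthogonal to the range satisfies `H y = conj z • y`. As `conj z = -l i`, the lower
    -- bound at `-l` forces `y = 0`.
    rw [← Submodule.orthogonal_eq_bot_iff, Submodule.eq_bot_iff]
    intro y hy
    have hy' : ∀ x : H.domain, inner ℂ ((starRingEnd ℂ z) • y) (x : 𝓗) = inner ℂ y (H x) := by
      intro x
      have h := Submodule.inner_left_of_mem_orthogonal (LinearMap.mem_range_self S x) hy
      rw [hS, inner_sub_right, inner_smul_right, sub_eq_zero] at h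
      rw [inner_smul_left, h, Complex.conj_conj]
    obtain ⟨hyd, hHy⟩ := mem_domain_of_forall_inner hH hy'
    have h := abs_mul_norm_le hH (-l) ⟨y, hyd⟩
    rw [hHy] at h
    have hc : starRingEnd ℂ z = ((-l : ℝ) : ℂ) * Complex.I := by
      simp [hz]
    rw [hc, sub_self, norm_zero, abs_neg] at h
    dsimp only at h
    have h0 : ‖y‖ = 0 := by nlinarith [norm_nonneg y]
    exact norm_eq_zero.1 h0
  let e : H.domain ≃ₗ[ℂ] 𝓗 := LinearEquiv.ofBijective S ⟨hinj, LinearMap.range_eq_top.1 htop⟩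
  have he : ∀ x, e x = H x - z • (x : 𝓗) := fun _ => rfl
  have hle : ∀ y, |l| * ‖(e.symm y : 𝓗)‖ ≤ ‖y‖ := fun y => by
    have := hbd (e.symm y)
    rwa [show S (e.symm y) = y from e.apply_symm_apply y] at this
  refine ⟨LinearMap.mkContinuous (H.domain.subtype ∘ₗ e.symm.toLinearMap) |l|⁻¹ fun y => ?_,
    ⟨fun y => (e.symm y).2, fun y => ?_, fun x => ?_⟩, hle⟩
  · rw [inv_mul_eq_div, le_div_iff₀' hl']
    exact hle y
  · have h := e.apply_symm_apply y
    rw [he, sub_eq_iff_eq_add] at h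
    exact h
  · change ((e.symm (e x) : H.domain) : 𝓗) = x
    rw [e.symm_apply_apply]

/-- Closed graph theorem: `H B` is bounded if `B` is bounded with values in the domain of `H`. -/
theorem exists_clm_eq_comp (hH : H.IsClosed) (B : 𝓗 →L[ℂ] 𝓗) (hB : ∀ y, B y ∈ H.domain) :
    ∃ K : 𝓗 →L[ℂ] 𝓗, ∀ y, K y = H ⟨B y, hB y⟩ := by
  let K : 𝓗 →ₗ[ℂ] 𝓗 := H.toFun ∘ₗ B.toLinearMap.codRestrict H.domain hB
  refine ⟨ContinuousLinearMap.ofSeqClosedGraph (g := K) fun u x y hu hy => ?_, fun y => rfl⟩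
  have hg : (B x, y) ∈ H.graph :=
    IsClosed.mem_of_tendsto (f := fun n => (B (u n), K (u n))) hH
      (((B.continuous.tendsto x).comp hu).prodMk_nhds hy)
      (Eventually.of_forall fun n => H.mem_graph ⟨B (u n), hB (u n)⟩)
  obtain ⟨x', h1, h2⟩ := (LinearPMap.mem_graph_iff H).1 hg
  dsimp only at h1 h2
  rw [← h2]
  exact congrArg H (Subtype.ext h1)

end SelfAdjoint

end Abstract

/-! ### The unitary group and Heisenberg evolution of bounded operators -/

section Propagator

variable {𝓗 : Type*} [NormedAddCommGroup 𝓗] [InnerProductSpace ℂ 𝓗]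
  {H : 𝓗 →ₗ.[ℂ] 𝓗} {U : ℝ → 𝓗 ≃ₗᵢ[ℂ] 𝓗}

namespace IsPropagator

theorem map_zero (hU : IsPropagator H U) (ψ : 𝓗) : U 0 ψ = ψ := by
  have h := hU.map_add 0 0 ψ
  rw [add_zero] at h
  exact ((U 0).injective h).symm

theorem map_neg_apply (hU : IsPropagator H U) (t : ℝ) (ψ : 𝓗) : U (-t) (U t ψ) = ψ := by
  rw [← hU.map_add, neg_add_cancel, hU.map_zero]

theorem map_apply_neg (hU : IsPropagator H U) (t : ℝ) (ψ : 𝓗) : U t (U (-t) ψ) = ψ := by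
  rw [← hU.map_add, add_neg_cancel, hU.map_zero]

theorem hasDerivAt_zero (hU : IsPropagator H U) (x : H.domain) :
    HasDerivAt (fun t => U t x) (-(Complex.I • H x)) 0 :=
  (hU.hasDerivAt_iff _ _).2 ⟨x.2, rfl⟩

theorem hasDerivAt_map (hU : IsPropagator H U) (x : H.domain) (t : ℝ) :
    HasDerivAt (fun s => U s x) (U t (-(Complex.I • H x))) t := by
  have h : HasDerivAt (fun s => U t (U s x)) (U t (-(Complex.I • H x))) 0 :=
    ((U t).toContinuousLinearEquiv.toContinuousLinearMap.restrictScalars ℝ).hasFDerivAt.comp_hasDerivAt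
      0 (hU.hasDerivAt_zero x)
  have h' : HasDerivAt (fun s => U t (U s x)) (U t (-(Complex.I • H x))) (t - t) := by
    rwa [sub_self]
  refine (h'.comp_sub_const t t).congr_of_eventuallyEq (Eventually.of_forall fun s => ?_)
  dsimp only
  rw [← hU.map_add, add_sub_cancel]

/-- The orbit of `U t x` is a time translate of the orbit of `x`, hence differentiable at `0`;
`hasDerivAt_iff` turns this back into membership in the domain. -/
theorem map_mem_domain (hU : IsPropagator H U) (t : ℝ) (x : H.domain) :
    ∃ h : U t x ∈ H.domain, H ⟨U t x, h⟩ = U t (H x) := by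
  have h := hU.hasDerivAt_map x t
  have h' : HasDerivAt (fun s => U s (U t x)) (U t (-(Complex.I • H x))) 0 := by
    have h0 : HasDerivAt (fun s => U s x) (U t (-(Complex.I • H x))) (0 + t) := by rwa [zero_add]
    refine (h0.comp_add_const 0 t).congr_of_eventuallyEq (Eventually.of_forall fun s => ?_)
    dsimp only
    rw [← hU.map_add]
  obtain ⟨hd, he⟩ := (hU.hasDerivAt_iff _ _).1 h'
  refine ⟨hd, ?_⟩
  rw [map_neg, map_smul, neg_inj] at he
  exact (smul_right_injective 𝓗 Complex.I_ne_zero he).symm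

theorem resolvent_comm (hU : IsPropagator H U) {z : ℂ} {R : 𝓗 →L[ℂ] 𝓗} (hR : IsResolvent H z R)
    (t : ℝ) (ψ : 𝓗) : R (U t ψ) = U t (R ψ) := by
  obtain ⟨h, he⟩ := hU.map_mem_domain t ⟨R ψ, hR.mem_domain ψ⟩
  have h1 := hR.apply_left ⟨U t (R ψ), h⟩
  rw [he, hR.apply_right, _root_.map_add, map_smul, add_sub_cancel_right] at h1
  exact h1

/-- The function `s ↦ e^{isE} U s φ` has zero derivative, so it is constant. -/
theorem map_eigenvector (hU : IsPropagator H U) {E : ℝ} {φ : 𝓗} (h : φ ∈ H.domain)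
    (hE : H ⟨φ, h⟩ = (E : ℂ) • φ) (t : ℝ) : ∃ c : ℂ, ‖c‖ = 1 ∧ U t φ = c • φ := by
  have hexp : ∀ s : ℝ, HasDerivAt (fun s : ℝ => Complex.exp (s * (E * Complex.I)))
      (Complex.exp (s * (E * Complex.I)) * (E * Complex.I)) s := fun s => by
    have := ((hasDerivAt_id (s : ℂ)).mul_const (E * Complex.I)).cexp.comp_ofReal
    simpa using this
  have hder : ∀ s : ℝ, HasDerivAt (fun s : ℝ => Complex.exp (s * (E * Complex.I)) • U s φ) 0 s := by
    intro s
    have := (hexp s).smul (hU.hasDerivAt_map ⟨φ, h⟩ s)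
    refine this.congr_deriv ?_
    dsimp only
    rw [hE, map_neg, map_smul, map_smul]
    module
  have hconst : Complex.exp (t * (E * Complex.I)) • U t φ = φ := by
    have := is_const_of_deriv_eq_zero (fun s => (hder s).differentiableAt)
      (fun s => (hder s).deriv) t 0
    simpa [hU.map_zero] using this
  refine ⟨Complex.exp ((-t * E : ℝ) * Complex.I), Complex.norm_exp_ofReal_mul_I _, ?_⟩
  conv_rhs => rw [← hconst]
  rw [smul_smul, ← Complex.exp_add]
  have : ((-t * E : ℝ) : ℂ) * Complex.I + t * (E * Complex.I) = 0 := by push_cast; ring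
  rw [this, Complex.exp_zero, one_smul]

end IsPropagator

variable [CompleteSpace 𝓗]

/-- The Heisenberg evolution of a bounded operator moves with speed at most the supremum of its
commutator with `H` along the trajectory. -/
theorem norm_heisenberg_sub_le (hH : IsSelfAdjoint H) (hU : IsPropagator H U) (B : 𝓗 →L[ℂ] 𝓗)
    (hB : ∀ x ∈ H.domain, B x ∈ H.domain) (x : H.domain) {η : ℝ}
    (hη : ∀ (s : ℝ) (h : U s x ∈ H.domain), ‖H ⟨B (U s x), hB _ h⟩ - B (H ⟨U s x, h⟩)‖ ≤ η)
    {t : ℝ} (ht : 0 ≤ t) : ‖U (-t) (B (U t x)) - B x‖ ≤ η * t := by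
  have hη0 : 0 ≤ η := (norm_nonneg _).trans (hη 0 (hU.map_mem_domain 0 x).1)
  -- Tested against `χ ∈ D(H)`, the evolution becomes `⟨U s χ, B (U s x)⟩`, whose derivative is `i
  -- ⟨U s χ, [H, B] U s x⟩` by symmetry of `H`; the mean value inequality then applies.
  have key : ∀ χ : H.domain,
      ‖inner ℂ (χ : 𝓗) (U (-t) (B (U t x)) - B x)‖ ≤ η * t * ‖(χ : 𝓗)‖ := by
    intro χ
    have hd : ∀ s : ℝ, ∃ c : ℂ, HasDerivAt (fun s => inner ℂ (U s χ) (B (U s x))) c s ∧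
        ‖c‖ ≤ η * ‖(χ : 𝓗)‖ := by
      intro s
      obtain ⟨h1, e1⟩ := hU.map_mem_domain s χ
      obtain ⟨h2, e2⟩ := hU.map_mem_domain s x
      have hBd : HasDerivAt (fun s => B (U s x)) (B (U s (-(Complex.I • H x)))) s :=
        (B.restrictScalars ℝ).hasFDerivAt.comp_hasDerivAt s (hU.hasDerivAt_map x s)
      refine ⟨_, (hU.hasDerivAt_map χ s).inner ℂ hBd, ?_⟩
      have hs := inner_apply_left_eq hH ⟨_, h1⟩ ⟨_, hB _ h2⟩
      have : inner ℂ (U s χ) (B (U s (-(Complex.I • H x)))) +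
          inner ℂ (U s (-(Complex.I • H χ))) (B (U s x)) =
          Complex.I * inner ℂ (U s χ) (H ⟨B (U s x), hB _ h2⟩ - B (H ⟨U s x, h2⟩)) := by
        rw [inner_sub_right, ← hs, e1, e2]
        simp only [map_neg, map_smul, inner_neg_left, inner_neg_right, inner_smul_left,
          inner_smul_right, Complex.conj_I]
        ring
      rw [this, norm_mul, Complex.norm_I, one_mul]
      calc _ ≤ ‖U s χ‖ * ‖H ⟨B (U s x), hB _ h2⟩ - B (H ⟨U s x, h2⟩)‖ := norm_inner_le_norm _ _
        _ ≤ ‖(χ : 𝓗)‖ * η := by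
          rw [(U s).norm_map]
          exact mul_le_mul_of_nonneg_left (hη s h2) (norm_nonneg _)
        _ = η * ‖(χ : 𝓗)‖ := mul_comm _ _
    choose c hc hcle using hd
    have h := norm_image_sub_le_of_norm_deriv_le_segment' (a := 0) (b := t)
      (fun s _ => (hc s).hasDerivWithinAt) (fun s _ => hcle s) t ⟨ht, le_rfl⟩
    have hU0 : inner ℂ (U t χ) (B (U t x)) = inner ℂ (χ : 𝓗) (U (-t) (B (U t x))) := by
      rw [← (U (-t)).inner_map_map, hU.map_neg_apply]
    rw [hU0, hU.map_zero, hU.map_zero, ← inner_sub_right, sub_zero] at h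
    linarith
  have hall : ∀ χ : 𝓗, ‖inner ℂ χ (U (-t) (B (U t x)) - B x)‖ ≤ η * t * ‖χ‖ := by
    intro χ
    refine hH.dense_domain.induction (P := fun χ => ‖inner ℂ χ (U (-t) (B (U t x)) - B x)‖ ≤
      η * t * ‖χ‖) (fun χ hχ => key ⟨χ, hχ⟩) ?_ χ
    exact isClosed_le (by fun_prop) (by fun_prop)
  -- Testing the difference against itself recovers its norm.
  have h := hall (U (-t) (B (U t x)) - B x)
  rw [inner_self_eq_norm_sq_to_K, norm_pow, RCLike.norm_ofReal, abs_norm, sq] at h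
  set v := ‖U (-t) (B (U t x)) - B x‖
  have hv : 0 ≤ v := norm_nonneg _
  rcases hv.eq_or_lt with h0 | h0
  · rw [← h0]; positivity
  · exact le_of_mul_le_mul_right h h0

end Propagator

/-! ### Vanishing of the velocity on the pure point subspace -/

section Core

theorem exists_forall_norm_le_of_cauchySeq {E : Type*} [NormedAddCommGroup E] {u : ℕ → E} (hu : CauchySeq u) :
    ∃ C, ∀ n, ‖u n‖ ≤ C := by
  obtain ⟨C, hC⟩ := hu.isBounded_range.exists_norm_le
  exact ⟨C, fun n => hC _ ⟨n, rfl⟩⟩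

variable {𝓗 : Type*} [NormedAddCommGroup 𝓗] [InnerProductSpace ℂ 𝓗]

/-- Bounded operators `G n` that regularize the operator `A`, preserve the domain of `H`, and whose
commutators with `H` converge strongly on the domain of `H`. -/
structure Regularizes (H A : 𝓗 →ₗ.[ℂ] 𝓗) (G : ℕ → 𝓗 →L[ℂ] 𝓗) : Prop where
  tendsto : ∀ x : A.domain, Tendsto (fun n => G n x) atTop (𝓝 (A x))
  mem_domain : ∀ x, (∃ C, ∀ n, ‖G n x‖ ≤ C) → x ∈ A.domain
  map_domain : ∀ n, ∀ x ∈ H.domain, G n x ∈ H.domain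
  cauchy : ∀ x : H.domain,
    CauchySeq fun n => H ⟨G n x, map_domain n x x.2⟩ - G n (H x)

variable [CompleteSpace 𝓗] {H A : 𝓗 →ₗ.[ℂ] 𝓗} {U : ℝ → 𝓗 ≃ₗᵢ[ℂ] 𝓗} {z : ℂ} {R : 𝓗 →L[ℂ] 𝓗}
  {G : ℕ → 𝓗 →L[ℂ] 𝓗}

/-- On the pure point subspace a strongly convergent sequence of operators converges uniformly
along every trajectory. -/
theorem IsPropagator.uniform_cauchy (hU : IsPropagator H U) {T : ℕ → 𝓗 →L[ℂ] 𝓗}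
    (hT : ∀ y, CauchySeq fun n => T n y) {ψ : 𝓗} (hψ : ψ ∈ purePointSubspace H) {η : ℝ}
    (hη : 0 < η) : ∃ m, ∀ n ≥ m, ∀ s, ‖T n (U s ψ) - T m (U s ψ)‖ ≤ η := by
  suffices ∃ m, ∀ n ≥ m, ∀ k ≥ m, ∀ s, ‖T n (U s ψ) - T k (U s ψ)‖ ≤ η by
    obtain ⟨m, hm⟩ := this
    exact ⟨m, fun n hn => hm n hn m le_rfl⟩
  -- The uniform bound on `‖T n‖` is what allows passing from the span of the eigenvectors to its
  -- closure.
  obtain ⟨C, hC⟩ := banach_steinhaus fun y => exists_forall_norm_le_of_cauchySeq (hT y)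
  have hC0 : 0 ≤ C := (norm_nonneg _).trans (hC 0)
  have hspan : ∀ φ ∈ Submodule.span ℂ
      {φ : 𝓗 | ∃ (E : ℝ) (h : φ ∈ H.domain), H ⟨φ, h⟩ = (E : ℂ) • φ},
      ∀ η > 0, ∃ m, ∀ n ≥ m, ∀ k ≥ m, ∀ s, ‖T n (U s φ) - T k (U s φ)‖ ≤ η := by
    intro φ hφ
    induction hφ using Submodule.span_induction with
    | mem φ hφ =>
      obtain ⟨E, h, hE⟩ := hφ
      intro η hη
      obtain ⟨m, hm⟩ := Metric.cauchySeq_iff.1 (hT φ) η hη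
      refine ⟨m, fun n hn k hk s => ?_⟩
      obtain ⟨c, hc, hUc⟩ := hU.map_eigenvector h hE s
      -- The trajectory of an eigenvector consists of unimodular multiples of it, so the estimate at
      -- time `0` holds at all times.
      rw [hUc, map_smul, map_smul, ← smul_sub, norm_smul, hc, one_mul, ← dist_eq_norm]
      exact (hm n hn k hk).le
    | zero => exact fun η hη => ⟨0, fun n _ k _ s => by simpa using hη.le⟩
    | add φ χ _ _ h1 h2 =>
      intro η hη
      obtain ⟨m1, hm1⟩ := h1 (η / 2) (half_pos hη)
      obtain ⟨m2, hm2⟩ := h2 (η / 2) (half_pos hη)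
      refine ⟨max m1 m2, fun n hn k hk s => ?_⟩
      have e1 := hm1 n (le_of_max_le_left hn) k (le_of_max_le_left hk) s
      have e2 := hm2 n (le_of_max_le_right hn) k (le_of_max_le_right hk) s
      rw [_root_.map_add, _root_.map_add, _root_.map_add, add_sub_add_comm]
      exact (norm_add_le _ _).trans (by linarith)
    | smul c φ _ h =>
      intro η hη
      obtain ⟨m, hm⟩ := h (η / (‖c‖ + 1)) (by positivity)
      refine ⟨m, fun n hn k hk s => ?_⟩
      rw [map_smul, map_smul, map_smul, ← smul_sub, norm_smul]
      calc ‖c‖ * ‖T n (U s φ) - T k (U s φ)‖ ≤ (‖c‖ + 1) * (η / (‖c‖ + 1)) :=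
            mul_le_mul (by linarith) (hm n hn k hk s) (norm_nonneg _) (by positivity)
        _ = η := by field_simp
  -- With this radius each of `T n` and `T k` contributes at most `η / 4` on `ψ - φ`; the `+ 1`
  -- keeps the denominator positive when `C = 0`.
  obtain ⟨φ, hφ, hd⟩ := Metric.mem_closure_iff.1 hψ (η / (4 * (C + 1))) (by positivity)
  obtain ⟨m, hm⟩ := hspan φ hφ (η / 2) (half_pos hη)
  refine ⟨m, fun n hn k hk s => ?_⟩
  have hsplit : T n (U s ψ) - T k (U s ψ) = (T n (U s φ) - T k (U s φ)) +
      (T n (U s (ψ - φ)) - T k (U s (ψ - φ))) := by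
    simp only [map_sub]
    abel
  have hb : ∀ j, ‖T j (U s (ψ - φ))‖ ≤ η / 4 := fun j => by
    refine ((T j).le_of_opNorm_le (hC j) _).trans ?_
    rw [(U s).norm_map, ← dist_eq_norm]
    calc C * dist ψ φ ≤ (C + 1) * (η / (4 * (C + 1))) :=
          mul_le_mul (by linarith) hd.le dist_nonneg (by positivity)
      _ = η / 4 := by field_simp
  rw [hsplit]
  refine (norm_add_le _ _).trans ?_
  have h1 := hm n hn k hk s
  have h2 := norm_sub_le (T n (U s (ψ - φ))) (T k (U s (ψ - φ)))
  linarith [hb n, hb k]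

namespace Regularizes

/-- Composing with the resolvent makes the commutators bounded and everywhere defined, by the closed
graph theorem, so that the uniform boundedness principle can be applied to them. -/
theorem exists_commutator (hG : Regularizes H A G) (hH : IsSelfAdjoint H)
    (hR : IsResolvent H z R) : ∃ T : ℕ → 𝓗 →L[ℂ] 𝓗,
      (∀ n y, T n y = H ⟨G n (R y), hG.map_domain n _ (hR.mem_domain y)⟩ -
        G n (H ⟨R y, hR.mem_domain y⟩)) ∧ ∀ y, CauchySeq fun n => T n y := by
  have h1 := fun n => exists_clm_eq_comp hH.isClosed (G n ∘L R)
    (fun y => hG.map_domain n _ (hR.mem_domain y))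
  obtain ⟨K, hK⟩ := exists_clm_eq_comp hH.isClosed R hR.mem_domain
  choose L hL using h1
  have hT : ∀ n y, (L n - G n ∘L K) y = H ⟨G n (R y), hG.map_domain n _ (hR.mem_domain y)⟩ -
      G n (H ⟨R y, hR.mem_domain y⟩) := fun n y => by
    rw [sub_apply, ContinuousLinearMap.comp_apply, hL, hK]
    rfl
  refine ⟨fun n => L n - G n ∘L K, hT, fun y => ?_⟩
  simp only [hT]
  exact hG.cauchy ⟨R y, hR.mem_domain y⟩

/-- The resolvent preserves the domain of the regularized operator. -/
theorem resolvent_mem_domain (hG : Regularizes H A G) (hH : IsSelfAdjoint H)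
    (hR : IsResolvent H z R) {ψ : 𝓗} (hψ : ψ ∈ A.domain) : R ψ ∈ A.domain := by
  obtain ⟨T, hT, hTc⟩ := hG.exists_commutator hH hR
  obtain ⟨C, hC⟩ := exists_forall_norm_le_of_cauchySeq
    ((hTc ψ).add (hG.tendsto ⟨ψ, hψ⟩).cauchySeq)
  refine hG.mem_domain _ ⟨‖R‖ * C, fun n => ?_⟩
  -- Commuting `H - z` past `G n` gives `(H - z) G n R ψ = T n ψ + G n ψ`. The right side is bounded
  -- in `n`, hence so is `G n R ψ`.
  have h : R (T n ψ + G n ψ) = G n (R ψ) := by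
    have h1 := hR.apply_left ⟨G n (R ψ), hG.map_domain n _ (hR.mem_domain ψ)⟩
    refine Eq.trans (congrArg R ?_) h1
    rw [hT, hR.apply_right, map_add, map_smul]
    dsimp only
    abel
  rw [← h]
  exact (R.le_opNorm _).trans (mul_le_mul_of_nonneg_left (hC n) (norm_nonneg _))

/-- The asymptotic velocity vanishes on vectors `R ψ` with `ψ` in the pure point subspace. -/
theorem velocity_eq_zero (hG : Regularizes H A G) (hH : IsSelfAdjoint H) (hU : IsPropagator H U)
    (hR : IsResolvent H z R) {ψ : 𝓗} (hψ : ψ ∈ purePointSubspace H) (hψA : R ψ ∈ A.domain)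
    {f : ℝ → 𝓗} (hf : ∀ᶠ t in atTop, (U t (R ψ), f t) ∈ A.graph) {P : 𝓗}
    (hP : Tendsto (fun t : ℝ => (t : ℂ)⁻¹ • U (-t) (f t)) atTop (𝓝 P)) : P = 0 := by
  obtain ⟨T, hT, hTc⟩ := hG.exists_commutator hH hR
  suffices ∀ η > 0, ‖P‖ ≤ η from
    norm_le_zero_iff.1 (le_of_forall_pos_le_add fun η hη => by simpa using this η hη)
  intro η hη
  obtain ⟨m, hm⟩ := hU.uniform_cauchy hTc hψ hη
  set x : 𝓗 := R ψ
  set K : ℝ := ‖G m‖ * ‖x‖ + ‖A ⟨x, hψA⟩ - G m x‖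
  -- Since `U s (R ψ) = R (U s ψ)`, the commutator of `H` with `G n - G m` at this point is `(T n -
  -- T m) (U s ψ)`, which is at most `η` for all times.
  have hspeed : ∀ n ≥ m, ∀ t ≥ 0,
      ‖U (-t) ((G n - G m) (U t x)) - (G n - G m) x‖ ≤ η * t := by
    intro n hn t ht
    refine norm_heisenberg_sub_le hH hU (G n - G m) (fun y hy => H.domain.sub_mem
      (hG.map_domain n y hy) (hG.map_domain m y hy)) ⟨x, hR.mem_domain ψ⟩ (fun s h => ?_) ht
    have h1 := hm n hn s
    rw [hT, hT] at h1
    simp only [hU.resolvent_comm hR] at h1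
    refine le_of_eq_of_le (congrArg norm ?_) h1
    have h2 := H.map_sub ⟨G n (U s x), hG.map_domain n _ h⟩ ⟨G m (U s x), hG.map_domain m _ h⟩
    have h3 : (⟨G n (U s x), hG.map_domain n _ h⟩ - ⟨G m (U s x), hG.map_domain m _ h⟩ :
        H.domain) = ⟨(G n - G m) (U s x), H.domain.sub_mem
          (hG.map_domain n _ h) (hG.map_domain m _ h)⟩ := rfl
    rw [h3] at h2
    dsimp only
    rw [h2, sub_apply]
    abel
  have hbound : ∀ᶠ t : ℝ in atTop, ‖(t : ℂ)⁻¹ • U (-t) (f t)‖ ≤ η + K * t⁻¹ := by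
    filter_upwards [hf, eventually_gt_atTop 0] with t hft ht
    obtain ⟨y, hy, hy'⟩ := (LinearPMap.mem_graph_iff A).1 hft
    dsimp only at hy hy'
    have hl1 : Tendsto (fun n => G n (U t x)) atTop (𝓝 (f t)) := by
      rw [← hy, ← hy']
      exact hG.tendsto y
    have hl2 : Tendsto (fun n => G n x) atTop (𝓝 (A ⟨x, hψA⟩)) := hG.tendsto ⟨x, hψA⟩
    -- The speed bound is uniform in `n`, so it survives `n → ∞` at fixed `t`, where `G n` becomes
    -- `A`.
    have hlim : ‖U (-t) (f t - G m (U t x)) - (A ⟨x, hψA⟩ - G m x)‖ ≤ η * t := by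
      refine le_of_tendsto (((((U (-t)).continuous.tendsto _).comp
        (hl1.sub_const (G m (U t x)))).sub (hl2.sub_const (G m x))).norm) ?_
      filter_upwards [eventually_ge_atTop m] with n hn
      exact hspeed n hn t ht.le
    have hfin : ‖U (-t) (f t)‖ ≤ η * t + K := by
      have he : U (-t) (f t) = (U (-t) (f t - G m (U t x)) - (A ⟨x, hψA⟩ - G m x)) +
          (U (-t) (G m (U t x)) + (A ⟨x, hψA⟩ - G m x)) := by
        rw [map_sub]
        abel
      rw [he]
      refine (norm_add_le _ _).trans (add_le_add hlim ((norm_add_le _ _).trans ?_))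
      refine add_le_add ?_ le_rfl
      rw [(U (-t)).norm_map]
      refine ((G m).le_opNorm _).trans (le_of_eq ?_)
      rw [(U t).norm_map]
    rw [norm_smul, norm_inv, Complex.norm_real, Real.norm_of_nonneg ht.le, inv_mul_le_iff₀ ht]
    refine hfin.trans (le_of_eq ?_)
    field_simp
  refine le_of_tendsto_of_tendsto hP.norm ?_ hbound
  simpa using (tendsto_inv_atTop_zero.const_mul K).const_add η

end Regularizes

end Core

/-! ### From coordinates to the position operator -/

section Position

variable {X : Type*} [MeasurableSpace X] {d : ℕ}

/-- If the coordinates can be regularized compatibly with `H`, then strong ballistic transport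
excludes localized vectors from the pure point subspace. -/
theorem purePointSubspace_subset {μ : Measure X} {q : Fin d → X → ℝ}
    {H : Lp ℂ 2 μ →ₗ.[ℂ] Lp ℂ 2 μ} (hH : IsSelfAdjoint H) (hU : ∃ U, IsPropagator H U)
    (hG : ∀ j, ∃ G, Regularizes H (mulOp μ (q j)) G)
    (hB : ∀ ψ : Lp ℂ 2 μ, ψ ≠ 0 → ψ ∈ (positionOp μ q).domain → ψ ∈ H.domain →
      StrongBallisticTransport H (positionOp μ q) ψ) :
    (purePointSubspace H : Set (Lp ℂ 2 μ)) ⊆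
      {0} ∪ (Set.univ \ ((positionOp μ q).domain : Set (Lp ℂ 2 μ))) := by
  intro ψ hψ
  by_contra hcon
  rw [Set.mem_union, not_or, Set.mem_singleton_iff] at hcon
  obtain ⟨h0, hQ⟩ := hcon
  have hQ' : ψ ∈ (positionOp μ q).domain := by
    by_contra h
    exact hQ ⟨Set.mem_univ _, h⟩
  have hprop : IsPropagator H (propagator H) := by
    rw [propagator, dif_pos hU]
    exact hU.choose_spec
  -- The transport hypothesis concerns only vectors of `D(H)`, so it is applied to `R ψ` instead of
  -- `ψ`.
  obtain ⟨R, hR, -⟩ := exists_isResolvent hH one_ne_zero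
  have hdom : ∀ j, R ψ ∈ (mulOp μ (q j)).domain := fun j => by
    obtain ⟨G, hGj⟩ := hG j
    exact hGj.resolvent_mem_domain hH hR ((Submodule.mem_iInf _).1 hQ' j)
  obtain ⟨P, hP0, f, hf, hlim⟩ :=
    hB (R ψ) (hR.ne_zero h0) ((Submodule.mem_iInf _).2 hdom) (hR.mem_domain ψ)
  refine hP0 ?_
  ext1 j
  obtain ⟨G, hGj⟩ := hG j
  -- Here `f t` already carries the outer factor `e^{itH}`; applying `e^{-itH}` recovers `q_j
  -- e^{-itH} R ψ`, as the lemma expects.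
  refine hGj.velocity_eq_zero hH hprop hR hψ (hdom j) (f := fun t => propagator H t (f t j)) ?_ ?_
  · filter_upwards [hf] with t ht
    obtain ⟨y, hy, hy'⟩ := (LinearPMap.mem_graph_iff _).1 ht
    dsimp only at hy hy'
    rw [LinearPMap.mem_graph_iff]
    have hyQ : propagator H t y ∈ (positionOp μ q).domain := y.2
    refine ⟨⟨propagator H t y, (Submodule.mem_iInf _).1 hyQ j⟩, by rw [← hy], ?_⟩
    rw [← hy']
    exact (hprop.map_apply_neg t _).symm
  · have h := ((PiLp.continuous_apply 2 _ j).tendsto P).comp hlim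
    refine h.congr fun t => ?_
    simp only [Function.comp_apply, PiLp.smul_apply, hprop.map_neg_apply]

end Position

/-! ### Phases, their difference quotients, and multiplication operators -/

section Phase

variable {X : Type*}

/-- The function `e^{iεq}`. -/
def phase (q : X → ℝ) (ε : ℝ) (x : X) : ℂ := Complex.exp ((ε * q x : ℝ) * Complex.I)

theorem norm_phase (q : X → ℝ) (ε : ℝ) (x : X) : ‖phase q ε x‖ = 1 :=
  Complex.norm_exp_ofReal_mul_I _

/-- The step sizes `1 / (n + 1)`. -/
def step (n : ℕ) : ℝ := 1 / ((n : ℝ) + 1)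

theorem step_pos (n : ℕ) : 0 < step n := Nat.one_div_pos_of_nat

theorem tendsto_step : Tendsto step atTop (𝓝 0) := tendsto_one_div_add_atTop_nhds_zero_nat

theorem tendsto_phase (q : X → ℝ) (x : X) :
    Tendsto (fun n => phase q (step n) x) atTop (𝓝 1) := by
  have h : Continuous fun ε : ℝ => phase q ε x := by unfold phase; fun_prop
  have := (h.tendsto 0).comp tendsto_step
  simpa [phase, Function.comp_def] using this

/-- From `|e^{iθ} - 1| ≤ |θ|`. The bound does not depend on `n` and serves as the majorant for
dominated convergence. -/
theorem norm_quotient_le (q : X → ℝ) (n : ℕ) (x : X) :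
    ‖((step n : ℂ) * Complex.I)⁻¹ * (phase q (step n) x - 1)‖ ≤ |q x| := by
  have hs := step_pos n
  rw [norm_mul, norm_inv, norm_mul, Complex.norm_I, mul_one, Complex.norm_real,
    Real.norm_of_nonneg hs.le, inv_mul_le_iff₀ hs]
  have h := Real.norm_exp_I_mul_ofReal_sub_one_le (x := step n * q x)
  rw [mul_comm Complex.I, Real.norm_eq_abs, abs_mul, abs_of_pos hs] at h
  exact h

theorem tendsto_quotient (q : X → ℝ) (x : X) :
    Tendsto (fun n => ((step n : ℂ) * Complex.I)⁻¹ * (phase q (step n) x - 1)) atTop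
      (𝓝 (q x)) := by
  have hd : HasDerivAt (fun ε : ℝ => phase q ε x) (q x * Complex.I) 0 := by
    have h1 : HasDerivAt (fun ε : ℝ => ((ε * q x : ℝ) : ℂ) * Complex.I) (q x * Complex.I) 0 := by
      have := (((hasDerivAt_id (0 : ℝ)).mul_const (q x)).ofReal_comp).mul_const Complex.I
      simpa using this
    simpa [phase] using h1.cexp
  have hsl := hd.tendsto_slope_zero
  have hst : Tendsto step atTop (𝓝[≠] 0) :=
    tendsto_nhdsWithin_iff.2 ⟨tendsto_step, Eventually.of_forall fun n => (step_pos n).ne'⟩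
  have := (hsl.comp hst).mul_const (Complex.I⁻¹)
  rw [mul_inv_cancel_right₀ Complex.I_ne_zero] at this
  refine this.congr fun n => ?_
  have h0 : phase q 0 x = 1 := by simp [phase]
  simp only [Function.comp_apply, zero_add, h0, Complex.real_smul, Complex.ofReal_inv, mul_inv]
  ring

end Phase

section Multipliers

variable {X : Type*} [MeasurableSpace X] {μ : Measure X}

/-- Dominated convergence in `L²`. -/
theorem tendsto_L2_of_dominated {u : ℕ → Lp ℂ 2 μ} {v : Lp ℂ 2 μ} {b : X → ℂ} (hb : MemLp b 2 μ)
    (hub : ∀ n, ∀ᵐ x ∂μ, ‖u n x‖ ≤ ‖b x‖)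
    (huv : ∀ᵐ x ∂μ, Tendsto (fun n => u n x) atTop (𝓝 (v x))) : Tendsto u atTop (𝓝 v) := by
  rw [Lp.tendsto_Lp_iff_tendsto_eLpNorm']
  have hnorm : ∀ w : X → ℂ, eLpNorm w 2 μ = (∫⁻ x, ‖w x‖ₑ ^ (2 : ℝ) ∂μ) ^ (1 / (2 : ℝ)) := fun w => by
    simpa using eLpNorm_eq_lintegral_rpow_enorm_toReal (μ := μ) (f := w) (p := 2) (by simp) (by simp)
  have hlim : Tendsto (fun n => ∫⁻ x, ‖(⇑(u n) - ⇑v) x‖ₑ ^ (2 : ℝ) ∂μ) atTop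
      (𝓝 (∫⁻ _, 0 ∂μ)) := by
    refine tendsto_lintegral_of_dominated_convergence' (fun x => ‖(2 : ℂ) * b x‖ₑ ^ (2 : ℝ))
      (fun n => ?_) (fun n => ?_) ?_ ?_
    · exact (((Lp.aestronglyMeasurable (u n)).sub (Lp.aestronglyMeasurable v)).enorm).pow_const _
    · filter_upwards [ae_all_iff.2 hub, huv] with x hx hx'
      have hv : ‖v x‖ ≤ ‖b x‖ := le_of_tendsto hx'.norm (Eventually.of_forall hx)
      refine ENNReal.rpow_le_rpow ?_ (by norm_num)
      rw [enorm_le_iff_norm_le, norm_mul, Complex.norm_ofNat, Pi.sub_apply]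
      exact (norm_sub_le _ _).trans (by linarith [hx n])
    · have h2 : MemLp (fun x => (2 : ℂ) * b x) 2 μ := hb.const_mul 2
      exact (lintegral_rpow_enorm_lt_top_of_eLpNorm_lt_top (by simp) (by simp) h2.2).ne
    · filter_upwards [huv] with x hx
      have h0 : Tendsto (fun n => ‖u n x - v x‖ₑ ^ (2 : ℝ)) atTop (𝓝 (‖v x - v x‖ₑ ^ (2 : ℝ))) :=
        ((ENNReal.continuous_rpow_const.tendsto _).comp (hx.sub_const (v x)).enorm)
      simpa using h0
  simp only [hnorm]
  have := (ENNReal.continuous_rpow_const (y := 1 / (2 : ℝ)).tendsto _).comp hlim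
  simpa [Function.comp_def] using this

/-- Multiplication by a bounded function. -/
def bddMul (g : X → ℂ) (hg : MemLp g ∞ μ) : Lp ℂ 2 μ →L[ℂ] Lp ℂ 2 μ :=
  LinearMap.mkContinuous
    { toFun := fun ψ => (hg.toLp g • ψ : Lp ℂ 2 μ)
      map_add' := fun _ _ => Lp.add_smul _ _ _
      map_smul' := fun c _ => (Lp.smul_comm c _ _).symm } ‖hg.toLp g‖
    fun _ => Lp.norm_smul_le _ _

theorem bddMul_apply (g : X → ℂ) (hg : MemLp g ∞ μ) (ψ : Lp ℂ 2 μ) :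
    bddMul g hg ψ = (hg.toLp g • ψ : Lp ℂ 2 μ) := rfl

theorem coeFn_bddMul (g : X → ℂ) (hg : MemLp g ∞ μ) (ψ : Lp ℂ 2 μ) :
    bddMul g hg ψ =ᵐ[μ] fun x => g x * ψ x := by
  rw [bddMul_apply]
  filter_upwards [Lp.coeFn_lpSMul (r := 2) (hg.toLp g) ψ, hg.coeFn_toLp] with x h1 h2
  rw [h1, Pi.smul_apply', h2, smul_eq_mul]

theorem coeFn_mulOp (f : X → ℝ) (ψ : (mulOp μ f).domain) :
    mulOp μ f ψ =ᵐ[μ] fun x => (f x : ℂ) * (ψ : Lp ℂ 2 μ) x :=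
  MemLp.coeFn_toLp ψ.2

/-- Bounded multiplication operators commute with multiplication operators. -/
theorem mulOp_bddMul (f : X → ℝ) (g : X → ℂ) (hg : MemLp g ∞ μ) (ψ : (mulOp μ f).domain) :
    ∃ h : bddMul g hg ψ ∈ (mulOp μ f).domain,
      mulOp μ f ⟨bddMul g hg ψ, h⟩ = bddMul g hg (mulOp μ f ψ) := by
  have he : (fun x => (f x : ℂ) * bddMul g hg ψ x) =ᵐ[μ] bddMul g hg (mulOp μ f ψ) := by
    filter_upwards [coeFn_bddMul g hg ψ, coeFn_bddMul g hg (mulOp μ f ψ), coeFn_mulOp f ψ]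
      with x h1 h2 h3
    rw [h1, h2, h3, mul_left_comm]
  have h : bddMul g hg ψ ∈ (mulOp μ f).domain := (Lp.memLp _).ae_eq he.symm
  exact ⟨h, Lp.ext ((coeFn_mulOp f ⟨_, h⟩).trans he)⟩

theorem memLp_phase {q : X → ℝ} (hq : Measurable q) (ε : ℝ) : MemLp (phase q ε) ∞ μ := by
  refine memLp_top_of_bound (Measurable.aestronglyMeasurable ?_) 1
    (Eventually.of_forall fun x => (norm_phase q ε x).le)
  unfold phase
  fun_prop

/-- Multiplication by `e^{iεq}`. -/
def phaseMul (μ : Measure X) {q : X → ℝ} (hq : Measurable q) (ε : ℝ) : Lp ℂ 2 μ →L[ℂ] Lp ℂ 2 μ :=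
  bddMul (phase q ε) (memLp_phase hq ε)

/-- The bounded regularization `(e^{iεq} - 1) / (iε)` of multiplication by `q`. -/
def phaseQuotient (μ : Measure X) {q : X → ℝ} (hq : Measurable q) (n : ℕ) :
    Lp ℂ 2 μ →L[ℂ] Lp ℂ 2 μ :=
  ((step n : ℂ) * Complex.I)⁻¹ • (phaseMul μ hq (step n) - ContinuousLinearMap.id ℂ _)

variable {q : X → ℝ}

theorem tendsto_phaseMul (hq : Measurable q) (ψ : Lp ℂ 2 μ) :
    Tendsto (fun n => phaseMul μ hq (step n) ψ) atTop (𝓝 ψ) := by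
  have hcoe := fun n => coeFn_bddMul (phase q (step n)) (memLp_phase (μ := μ) hq (step n)) ψ
  refine tendsto_L2_of_dominated (Lp.memLp ψ) (fun n => ?_) ?_
  · filter_upwards [hcoe n] with x hx
    rw [phaseMul, hx, norm_mul, norm_phase, one_mul]
  · filter_upwards [ae_all_iff.2 hcoe] with x hx
    simp only [phaseMul, hx]
    simpa using (tendsto_phase q x).mul_const (ψ x)

theorem phaseQuotient_apply (hq : Measurable q) (n : ℕ) (ψ : Lp ℂ 2 μ) :
    phaseQuotient μ hq n ψ =
      ((step n : ℂ) * Complex.I)⁻¹ • (phaseMul μ hq (step n) ψ - ψ) := rfl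

theorem coeFn_phaseQuotient (hq : Measurable q) (n : ℕ) (ψ : Lp ℂ 2 μ) :
    phaseQuotient μ hq n ψ =ᵐ[μ]
      fun x => ((step n : ℂ) * Complex.I)⁻¹ * (phase q (step n) x - 1) * ψ x := by
  rw [phaseQuotient_apply]
  filter_upwards [Lp.coeFn_smul ((step n : ℂ) * Complex.I)⁻¹ (phaseMul μ hq (step n) ψ - ψ),
    Lp.coeFn_sub (phaseMul μ hq (step n) ψ) ψ,
    coeFn_bddMul (phase q (step n)) (memLp_phase (μ := μ) hq (step n)) ψ] with x h1 h2 h3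
  rw [h1, Pi.smul_apply, h2, Pi.sub_apply, phaseMul, h3, smul_eq_mul]
  ring

theorem tendsto_phaseQuotient (hq : Measurable q) (ψ : (mulOp μ q).domain) :
    Tendsto (fun n => phaseQuotient μ hq n ψ) atTop (𝓝 (mulOp μ q ψ)) := by
  refine tendsto_L2_of_dominated (b := fun x => (q x : ℂ) * (ψ : Lp ℂ 2 μ) x) ψ.2
    (fun n => ?_) ?_
  · filter_upwards [coeFn_phaseQuotient hq n (ψ : Lp ℂ 2 μ)] with x hx
    rw [hx, norm_mul, norm_mul (q x : ℂ), Complex.norm_real, Real.norm_eq_abs]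
    exact mul_le_mul_of_nonneg_right (norm_quotient_le q n x) (norm_nonneg _)
  · filter_upwards [ae_all_iff.2 fun n => coeFn_phaseQuotient hq n (ψ : Lp ℂ 2 μ),
      coeFn_mulOp q ψ] with x hx hx'
    simp only [hx, hx']
    exact (tendsto_quotient q x).mul_const _

/-- Fatou's lemma: the quotients converge pointwise to `q ψ`, so bounded `L²` norms force `q ψ ∈
L²`. -/
theorem mem_domain_of_phaseQuotient_bounded (hq : Measurable q) {ψ : Lp ℂ 2 μ} {C : ℝ}
    (hC : ∀ n, ‖phaseQuotient μ hq n ψ‖ ≤ C) : ψ ∈ (mulOp μ q).domain := by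
  have hmeas : AEStronglyMeasurable (fun x => (q x : ℂ) * ψ x) μ :=
    (Complex.measurable_ofReal.comp hq).aestronglyMeasurable.mul (Lp.aestronglyMeasurable ψ)
  refine ⟨hmeas, ?_⟩
  have h := Lp.eLpNorm_lim_le_liminf_eLpNorm (μ := μ) (p := 2)
    (f := fun n => phaseQuotient μ hq n ψ) (fun n => Lp.aestronglyMeasurable _)
    (fun x => (q x : ℂ) * ψ x) (by
      filter_upwards [ae_all_iff.2 fun n => coeFn_phaseQuotient hq n ψ] with x hx
      simp only [hx]
      exact (tendsto_quotient q x).mul_const _)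
  refine h.trans_lt (lt_of_le_of_lt (liminf_le_of_le (a := ENNReal.ofReal C) (h :=
    fun b hb => ?_)) ENNReal.ofReal_lt_top)
  obtain ⟨n, hn⟩ := hb.exists
  refine hn.trans ?_
  rw [← Lp.enorm_def, ← ofReal_norm]
  exact ENNReal.ofReal_le_ofReal (hC n)

theorem mulOp_phaseMul (V : X → ℝ) (hq : Measurable q) (ε : ℝ) (ψ : (mulOp μ V).domain) :
    ∃ h : phaseMul μ hq ε ψ ∈ (mulOp μ V).domain,
      mulOp μ V ⟨phaseMul μ hq ε ψ, h⟩ = phaseMul μ hq ε (mulOp μ V ψ) :=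
  mulOp_bddMul V _ _ ψ

/-- The phase quotients regularize multiplication by `q` relative to `H₀ + M` as soon as `M`
commutes with the phases and the commutators of `H₀` with the phases are of first order in `ε`. -/
theorem regularizes_phaseQuotient (hq : Measurable q) (H₀ M : Lp ℂ 2 μ →ₗ.[ℂ] Lp ℂ 2 μ)
    (hM : ∀ ε (x : M.domain), ∃ h : phaseMul μ hq ε x ∈ M.domain,
      M ⟨phaseMul μ hq ε x, h⟩ = phaseMul μ hq ε (M x))
    (hdom : ∀ ε, ∀ x ∈ H₀.domain, phaseMul μ hq ε x ∈ H₀.domain)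
    (hcomm : ∀ x : H₀.domain, CauchySeq fun n => (step n : ℂ)⁻¹ •
      (H₀ ⟨phaseMul μ hq (step n) x, hdom _ x x.2⟩ - phaseMul μ hq (step n) (H₀ x))) :
    Regularizes (H₀ + M) (mulOp μ q) (phaseQuotient μ hq) := by
  have hW : ∀ ε, ∀ x ∈ (H₀ + M).domain, phaseMul μ hq ε x ∈ (H₀ + M).domain :=
    fun ε x hx => ⟨hdom ε x hx.1, (hM ε ⟨x, hx.2⟩).1⟩
  have hmap : ∀ n, ∀ x ∈ (H₀ + M).domain,
      phaseQuotient μ hq n x ∈ (H₀ + M).domain := fun n x hx =>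
    Submodule.smul_mem _ _ (Submodule.sub_mem _ (hW (step n) x hx) hx)
  refine ⟨tendsto_phaseQuotient hq, fun x ⟨C, hC⟩ => mem_domain_of_phaseQuotient_bounded hq hC,
    hmap, fun x => ?_⟩
  -- Both `M` and the identity part of the quotient drop out of the commutator, leaving that of `H₀`
  -- with the phase.
  have hx : ∀ n, (step n : ℂ)⁻¹ • Complex.I⁻¹ • (H₀ ⟨phaseMul μ hq (step n) x, hdom _ x x.2.1⟩ -
      phaseMul μ hq (step n) (H₀ ⟨x, x.2.1⟩)) =
      (H₀ + M) ⟨phaseQuotient μ hq n x, hmap n x x.2⟩ -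
        phaseQuotient μ hq n ((H₀ + M) x) := fun n => by
    have h1 : (⟨phaseQuotient μ hq n x, hmap n x x.2⟩ : (H₀ + M).domain) =
        ((step n : ℂ) * Complex.I)⁻¹ • (⟨phaseMul μ hq (step n) x, hW (step n) x x.2⟩ - x) :=
      Subtype.ext (phaseQuotient_apply hq n _)
    obtain ⟨hMd, hMe⟩ := hM (step n) ⟨x, x.2.2⟩
    have h2 : (H₀ + M) ⟨phaseMul μ hq (step n) x, hW (step n) x x.2⟩ =
        H₀ ⟨phaseMul μ hq (step n) x, hdom _ x x.2.1⟩ +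
          phaseMul μ hq (step n) (M ⟨x, x.2.2⟩) := by
      rw [← hMe]
      rfl
    have h3 : (H₀ + M) x = H₀ ⟨x, x.2.1⟩ + M ⟨x, x.2.2⟩ := rfl
    rw [h1, phaseQuotient_apply, LinearPMap.map_smul, LinearPMap.map_sub, h2, h3, map_add,
      ← smul_sub, mul_inv, mul_smul]
    congr 2
    abel
  simp only [← hx]
  have h := (uniformContinuous_const_smul Complex.I⁻¹).comp_cauchySeq (hcomm ⟨x, x.2.1⟩)
  simpa only [Function.comp_def, smul_comm Complex.I⁻¹] using h

end Multipliers

/-! ### Commutators with the discrete Laplacian -/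

section LatticeRegularization

variable {d : ℕ}

theorem measurable_coordZ (j : Fin d) : Measurable fun n : Fin d → ℤ => (n j : ℝ) :=
  Measurable.of_discrete

theorem shiftZ_phaseMul (j : Fin d) (m : Fin d → ℤ) (ε : ℝ) (ψ : L2Z d) :
    shiftZ m (phaseMul Measure.count (measurable_coordZ j) ε ψ) =
      phase (fun n : Fin d → ℤ => (n j : ℝ)) ε m •
        phaseMul Measure.count (measurable_coordZ j) ε (shiftZ m ψ) := by
  have hm := measurePreserving_add_right (Measure.count : Measure (Fin d → ℤ)) m
  refine Lp.ext ?_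
  have h1 := coeFn_bddMul (phase (fun n : Fin d → ℤ => (n j : ℝ)) ε)
    (memLp_phase (μ := Measure.count) (measurable_coordZ j) ε)
  filter_upwards [Lp.coeFn_compMeasurePreserving
      (phaseMul Measure.count (measurable_coordZ j) ε ψ) hm,
    hm.quasiMeasurePreserving.ae_eq_comp (h1 ψ), h1 (shiftZ m ψ),
    Lp.coeFn_compMeasurePreserving ψ hm,
    Lp.coeFn_smul (phase (fun n : Fin d → ℤ => (n j : ℝ)) ε m)
      (phaseMul Measure.count (measurable_coordZ j) ε (shiftZ m ψ))] with n e1 e2 e3 e4 e5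
  have hl : shiftZ m (phaseMul Measure.count (measurable_coordZ j) ε ψ) n =
      phaseMul Measure.count (measurable_coordZ j) ε ψ (n + m) := e1
  have hs : shiftZ m ψ n = ψ (n + m) := e4
  have e2' : phaseMul Measure.count (measurable_coordZ j) ε ψ (n + m) =
    phase (fun n : Fin d → ℤ => (n j : ℝ)) ε (n + m) * ψ (n + m) := e2
  rw [hl, e5, e2', Pi.smul_apply, phaseMul, e3, hs, smul_eq_mul, ← mul_assoc]
  congr 1
  simp only [phase, Pi.add_apply]
  rw [← Complex.exp_add]
  congr 1
  push_cast
  ring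

/-- By `shiftZ_phaseMul` the expression is `ε⁻¹ (e^{iεm_j} - 1) e^{iεq} (shiftZ m ψ)`, with limit `i
m_j • shiftZ m ψ`. -/
theorem tendsto_shiftZ_commutator (j : Fin d) (m : Fin d → ℤ) (ψ : L2Z d) :
    ∃ χ, Tendsto (fun n => (step n : ℂ)⁻¹ •
      (shiftZ m (phaseMul Measure.count (measurable_coordZ j) (step n) ψ) -
        phaseMul Measure.count (measurable_coordZ j) (step n) (shiftZ m ψ))) atTop (𝓝 χ) := by
  have h1 := tendsto_phaseMul (measurable_coordZ j) (shiftZ m ψ)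
  have h2 := (tendsto_quotient (fun n : Fin d → ℤ => (n j : ℝ)) m).const_mul Complex.I
  refine ⟨_, (h2.smul h1).congr fun n => ?_⟩
  rw [shiftZ_phaseMul, mul_inv, ← mul_assoc, mul_left_comm, mul_inv_cancel₀ Complex.I_ne_zero,
    mul_one, mul_smul, sub_smul, one_smul]

theorem regularizes_hamiltonianZ (V : (Fin d → ℤ) → ℝ) (j : Fin d) :
    Regularizes (hamiltonianZ d V) (mulOp Measure.count fun n => (n j : ℝ))
      (phaseQuotient Measure.count (measurable_coordZ j)) := by
  refine regularizes_phaseQuotient (measurable_coordZ j) _ _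
    (mulOp_phaseMul V (measurable_coordZ j)) (fun _ _ _ => Submodule.mem_top) fun x => ?_
  choose χ hχ using fun m => tendsto_shiftZ_commutator j m (x : L2Z d)
  have h := tendsto_finsetSum Finset.univ fun (k : Fin d) _ =>
    (hχ (Pi.single k 1)).add (hχ (-Pi.single k 1))
  refine (h.neg.congr fun n => ?_).cauchySeq
  have hL : ∀ y : L2Z d, (-laplacianZ d) ⟨y, Submodule.mem_top⟩ =
      -∑ k : Fin d, (shiftZ (Pi.single k 1) y + shiftZ (-Pi.single k 1) y - (2 : ℂ) • y) := by
    intro y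
    refine congrArg Neg.neg (LinearMap.sum_apply _ _ _)
  have hx : (-laplacianZ d) x = (-laplacianZ d) ⟨x, Submodule.mem_top⟩ := rfl
  rw [hx, hL, hL, map_neg, map_sum, ← neg_sub', ← Finset.sum_sub_distrib, smul_neg,
    Finset.smul_sum]
  congr 1
  refine Finset.sum_congr rfl fun k _ => ?_
  rw [← smul_add, map_sub, map_add, map_smul]
  congr 1
  abel

end LatticeRegularization

/-! ### Commutators with the Laplacian on `H²(ℝ^d)` -/

section ContinuumRegularization

open TemperedDistribution
open scoped LineDeriv

variable {d : ℕ}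

/-- All derivatives have modulus one. Temperate growth is what makes the phases act on tempered
distributions. -/
theorem hasTemperateGrowth_exp_mul_I :
    (fun t : ℝ => Complex.exp (t * Complex.I)).HasTemperateGrowth := by
  have hder : ∀ n : ℕ, iteratedDeriv n (fun t : ℝ => Complex.exp (t * Complex.I)) =
      fun t : ℝ => Complex.I ^ n * Complex.exp (t * Complex.I) := by
    intro n
    induction n with
    | zero => simp
    | succ n ih =>
      rw [iteratedDeriv_succ, ih]
      funext t
      have h := (((hasDerivAt_id (t : ℂ)).mul_const Complex.I).cexp.comp_ofReal).const_mul
        (Complex.I ^ n)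
      simp only [id_eq, one_mul] at h
      rw [h.deriv, pow_succ]
      ring
  refine ⟨(Complex.ofRealCLM.contDiff.mul contDiff_const).cexp, fun n => ⟨0, 1, fun t => ?_⟩⟩
  rw [norm_iteratedFDeriv_eq_norm_iteratedDeriv, hder, norm_mul, norm_pow, Complex.norm_I,
    Complex.norm_exp_ofReal_mul_I]
  simp

/-- The coordinate functions on `ℝ^d`. -/
abbrev coordR (j : Fin d) (x : EuclideanSpace ℝ (Fin d)) : ℝ := x j

theorem measurable_coordR (j : Fin d) : Measurable (coordR j) := by
  unfold coordR
  fun_prop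

theorem phase_coordR_hasTemperateGrowth (j : Fin d) (ε : ℝ) :
    (phase (coordR j) ε).HasTemperateGrowth :=
  hasTemperateGrowth_exp_mul_I.comp
    (ε • EuclideanSpace.proj (𝕜 := ℝ) j : EuclideanSpace ℝ (Fin d) →L[ℝ] ℝ).hasTemperateGrowth

theorem hasFDerivAt_phase_coordR (j : Fin d) (ε : ℝ) (x : EuclideanSpace ℝ (Fin d)) :
    HasFDerivAt (phase (coordR j) ε) (phase (coordR j) ε x • Complex.I •
      Complex.ofRealCLM.comp (ε • EuclideanSpace.proj (𝕜 := ℝ) j :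
        EuclideanSpace ℝ (Fin d) →L[ℝ] ℝ)) x := by
  have h : HasFDerivAt (fun x : EuclideanSpace ℝ (Fin d) => ((ε * coordR j x : ℝ) : ℂ) * Complex.I)
      (Complex.I • Complex.ofRealCLM.comp (ε • EuclideanSpace.proj (𝕜 := ℝ) j :
        EuclideanSpace ℝ (Fin d) →L[ℝ] ℝ)) x :=
    (Complex.ofRealCLM.comp (ε • EuclideanSpace.proj (𝕜 := ℝ) j :
        EuclideanSpace ℝ (Fin d) →L[ℝ] ℝ)).hasFDerivAt.mul_const Complex.I
  exact h.cexp

theorem lineDerivOp_smulLeftCLM_phase_schwartz (j : Fin d) (ε : ℝ) (m : EuclideanSpace ℝ (Fin d))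
    (u : 𝓢(EuclideanSpace ℝ (Fin d), ℂ)) :
    ∂_{m} (SchwartzMap.smulLeftCLM ℂ (phase (coordR j) ε) u) =
      SchwartzMap.smulLeftCLM ℂ (phase (coordR j) ε) (∂_{m} u) +
        (Complex.I * (ε * m j : ℝ)) • SchwartzMap.smulLeftCLM ℂ (phase (coordR j) ε) u := by
  ext x
  have hg := phase_coordR_hasTemperateGrowth j ε
  have hfun : (SchwartzMap.smulLeftCLM ℂ (phase (coordR j) ε) u : EuclideanSpace ℝ (Fin d) → ℂ) =
      phase (coordR j) ε * u := by
    funext x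
    rw [SchwartzMap.smulLeftCLM_apply_apply hg, smul_eq_mul, Pi.mul_apply]
  have hd := (hasFDerivAt_phase_coordR j ε x).mul (u.differentiableAt (x := x)).hasFDerivAt
  rw [SchwartzMap.lineDerivOp_apply_eq_fderiv, hfun, hd.fderiv, add_apply, add_apply,
    smul_apply (F := 𝓢(EuclideanSpace ℝ (Fin d), ℂ)), SchwartzMap.smulLeftCLM_apply_apply hg,
    SchwartzMap.smulLeftCLM_apply_apply hg, SchwartzMap.lineDerivOp_apply_eq_fderiv]
  simp
  ring

/-- The product rule for the distribution `e^{iεx_j} f`. -/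
theorem lineDerivOp_smulLeftCLM_phase (j : Fin d) (ε : ℝ) (m : EuclideanSpace ℝ (Fin d))
    (f : 𝓢'(EuclideanSpace ℝ (Fin d), ℂ)) :
    ∂_{m} (smulLeftCLM ℂ (phase (coordR j) ε) f) =
      smulLeftCLM ℂ (phase (coordR j) ε) (∂_{m} f) +
        (Complex.I * (ε * m j : ℝ)) • smulLeftCLM ℂ (phase (coordR j) ε) f := by
  ext u
  have h := congrArg f (lineDerivOp_smulLeftCLM_phase_schwartz j ε m u)
  rw [map_add, map_smul] at h
  simp only [lineDerivOp_apply_apply, smulLeftCLM_apply_apply, add_apply, smul_apply, map_neg]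
  rw [h]
  abel

/-- The phase depends on `x_j` alone, and conjugating by it turns `∂_j` into `∂_j + iε`, whose
square is `∂_j² + 2iε ∂_j - ε²`. -/
theorem laplacian_smulLeftCLM_phase (j : Fin d) (ε : ℝ) (f : 𝓢'(EuclideanSpace ℝ (Fin d), ℂ)) :
    Δ (smulLeftCLM ℂ (phase (coordR j) ε) f) =
      smulLeftCLM ℂ (phase (coordR j) ε) (Δ f +
        (2 * Complex.I * ε) • ∂_{EuclideanSpace.single j (1 : ℝ)} f - ((ε : ℂ) ^ 2) • f) := by
  set S := smulLeftCLM ℂ (phase (coordR j) ε) with hS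
  have hk : ∀ k : Fin d, ∂_{EuclideanSpace.single k (1 : ℝ)}
      (∂_{EuclideanSpace.single k (1 : ℝ)} (S f)) =
      S (∂_{EuclideanSpace.single k (1 : ℝ)} (∂_{EuclideanSpace.single k (1 : ℝ)} f)) +
      if k = j then (2 * Complex.I * ε) • S (∂_{EuclideanSpace.single j (1 : ℝ)} f) -
        ((ε : ℂ) ^ 2) • S f else 0 := by
    intro k
    rw [hS, lineDerivOp_smulLeftCLM_phase, LineDeriv.lineDerivOp_add, LineDeriv.lineDerivOp_smul,
      lineDerivOp_smulLeftCLM_phase, lineDerivOp_smulLeftCLM_phase, ← hS]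
    split_ifs with hkj
    · subst hkj
      simp only [PiLp.single_apply, if_true, mul_one]
      rw [smul_add, smul_smul, mul_mul_mul_comm, Complex.I_mul_I]
      module
    · simp only [PiLp.single_apply, if_neg (Ne.symm hkj), mul_zero, Complex.ofReal_zero]
      module
  rw [laplacian_eq_sum (EuclideanSpace.basisFun (Fin d) ℝ)]
  simp only [EuclideanSpace.basisFun_apply, hk]
  rw [Finset.sum_add_distrib, Finset.sum_ite_eq' Finset.univ j, if_pos (Finset.mem_univ j),
    ← map_sum, laplacian_eq_sum (EuclideanSpace.basisFun (Fin d) ℝ), map_sub, map_add, map_smul,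
    map_smul]
  simp only [EuclideanSpace.basisFun_apply]
  abel

/-- An `L²` function whose distributional Laplacian is in `L²` belongs to `H²`. -/
theorem mem_sobolevH2_of_laplacian {ψ g : L2R d}
    (h : Δ (Lp.toTemperedDistribution ψ) = Lp.toTemperedDistribution g) : ψ ∈ sobolevH2 d := by
  -- The Bessel symbol is `1 + ‖ξ‖²`, whereas `Δ` has symbol `-(2π)² ‖ξ‖²` in this normalization of
  -- the Fourier transform; hence the factor `(2π)⁻²`.
  have hb : besselPotential (EuclideanSpace ℝ (Fin d)) ℂ 2 (Lp.toTemperedDistribution ψ) =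
      Lp.toTemperedDistribution ψ -
        (((2 * Real.pi) ^ 2 : ℝ) : ℂ)⁻¹ • Δ (Lp.toTemperedDistribution ψ) := by
    have hsum : (fun x : EuclideanSpace ℝ (Fin d) =>
        (((1 + ‖x‖ ^ 2) ^ ((2 : ℝ) / 2) : ℝ) : ℂ)) =
        (fun _ => (1 : ℂ)) + fun x => Complex.ofReal (‖x‖ ^ 2) := by
      funext x
      simp
    rw [besselPotential, hsum, laplacian_eq_fourierMultiplierCLM, fourierMultiplierCLM_apply,
      smulLeftCLM_add (by fun_prop) (by fun_prop), add_apply, smulLeftCLM_const, one_smul,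
      FourierTransform.fourierInv_add, FourierTransform.fourierInv_fourier_eq,
      ← fourierMultiplierCLM_apply, ← Complex.coe_smul (-(2 * Real.pi) ^ 2), smul_smul]
    have hpi : ((2 * Real.pi) ^ 2 : ℝ) ≠ 0 := by positivity
    have hc : ((((2 * Real.pi) ^ 2 : ℝ) : ℂ)⁻¹ * ((-(2 * Real.pi) ^ 2 : ℝ) : ℂ)) = -1 := by
      rw [Complex.ofReal_neg, mul_neg, inv_mul_cancel₀ (by exact_mod_cast hpi)]
    rw [hc, neg_one_smul, sub_neg_eq_add]
  refine ⟨ψ - (((2 * Real.pi) ^ 2 : ℝ) : ℂ)⁻¹ • g, ?_⟩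
  rw [hb, h]
  simp only [← Lp.toTemperedDistributionCLM_apply, map_sub, map_smul]

theorem toTemperedDistribution_phaseMul (j : Fin d) (ε : ℝ) (ψ : L2R d) :
    Lp.toTemperedDistribution (phaseMul volume (measurable_coordR j) ε ψ) =
      smulLeftCLM ℂ (phase (coordR j) ε) (Lp.toTemperedDistribution ψ) :=
  Lp.toTemperedDistribution_smul_eq (phase_coordR_hasTemperateGrowth j ε) _ ψ

theorem toTemperedDistribution_laplacianR (ψ : (laplacianR d).domain) :
    Lp.toTemperedDistribution (laplacianR d ψ) = Δ (Lp.toTemperedDistribution (ψ : L2R d)) :=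
  (exists_laplacian_eq ψ).choose_spec

/-- The commutator of `Δ` with the phase contains `∂_j ψ`, which must be an `L²` function; it lies
in `H¹ ⊆ L²`. -/
theorem exists_lineDeriv_eq (j : Fin d) (ψ : sobolevH2 d) :
    ∃ g : L2R d, Lp.toTemperedDistribution g =
      ∂_{EuclideanSpace.single j (1 : ℝ)} (Lp.toTemperedDistribution (ψ : L2R d)) := by
  have h : MemSobolev 0 2 (∂_{EuclideanSpace.single j (1 : ℝ)}
      (Lp.toTemperedDistribution (ψ : L2R d))) :=
    (MemSobolev.lineDerivOp ψ.2).mono (by norm_num)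
  rw [memSobolev_zero_iff] at h
  exact h.imp fun _ => Eq.symm

theorem laplacianR_phaseMul (j : Fin d) (ε : ℝ) (ψ : (laplacianR d).domain) {g : L2R d}
    (hg : Lp.toTemperedDistribution g =
      ∂_{EuclideanSpace.single j (1 : ℝ)} (Lp.toTemperedDistribution (ψ : L2R d))) :
    ∃ h : phaseMul volume (measurable_coordR j) ε ψ ∈ (laplacianR d).domain,
      laplacianR d ⟨_, h⟩ = phaseMul volume (measurable_coordR j) ε
        (laplacianR d ψ + (2 * Complex.I * ε) • g - ((ε : ℂ) ^ 2) • (ψ : L2R d)) := by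
  have h : Δ (Lp.toTemperedDistribution (phaseMul volume (measurable_coordR j) ε (ψ : L2R d))) =
      Lp.toTemperedDistribution (phaseMul volume (measurable_coordR j) ε
        (laplacianR d ψ + (2 * Complex.I * ε) • g - ((ε : ℂ) ^ 2) • (ψ : L2R d))) := by
    rw [toTemperedDistribution_phaseMul, toTemperedDistribution_phaseMul,
      laplacian_smulLeftCLM_phase, ← hg, ← toTemperedDistribution_laplacianR]
    simp only [← Lp.toTemperedDistributionCLM_apply, map_sub, map_add, map_smul]
  have hd : phaseMul volume (measurable_coordR j) ε (ψ : L2R d) ∈ (laplacianR d).domain :=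
    mem_sobolevH2_of_laplacian h
  refine ⟨hd, toTemperedDistribution_injective ?_⟩
  dsimp only
  rw [toTemperedDistribution_laplacianR, h]

theorem regularizes_hamiltonianR (V : EuclideanSpace ℝ (Fin d) → ℝ) (j : Fin d) :
    Regularizes (hamiltonianR d V) (mulOp volume fun x => x j)
      (phaseQuotient volume (measurable_coordR j)) := by
  refine regularizes_phaseQuotient (measurable_coordR j) _ _
    (mulOp_phaseMul V (measurable_coordR j)) (fun ε x hx => ?_) fun x => ?_
  · obtain ⟨g, hg⟩ := exists_lineDeriv_eq j ⟨x, hx⟩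
    exact (laplacianR_phaseMul j ε ⟨x, hx⟩ hg).1
  · obtain ⟨g, hg⟩ := exists_lineDeriv_eq j x
    -- The commutator divided by `ε` is `e^{iεq} (-2i ∂_j ψ + ε ψ)`; the two terms are treated
    -- separately.
    have h1 := (tendsto_phaseMul (measurable_coordR j) g).const_smul (-(2 * Complex.I))
    have h2 := ((Complex.continuous_ofReal.tendsto _).comp tendsto_step).smul
      (tendsto_phaseMul (measurable_coordR j) (x : L2R d))
    refine ((h1.add h2).congr fun n => ?_).cauchySeq
    obtain ⟨hd, he⟩ := laplacianR_phaseMul j (step n) x hg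
    have he' : (-laplacianR d) ⟨phaseMul volume (measurable_coordR j) (step n) x, hd⟩ =
      -phaseMul volume (measurable_coordR j) (step n)
        (laplacianR d x + (2 * Complex.I * step n) • g - ((step n : ℂ) ^ 2) • (x : L2R d)) :=
      congrArg Neg.neg he
    have hx : (-laplacianR d) x = -laplacianR d x := rfl
    have hs : (step n : ℂ) ≠ 0 := Complex.ofReal_ne_zero.2 (step_pos n).ne'
    rw [he', hx, Function.comp_apply]
    simp only [map_sub, map_add, map_smul, map_neg]
    rw [eq_inv_smul_iff₀ hs]
    module

end ContinuumRegularization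

/-! ### Unitary groups of bounded self-adjoint operators -/

section BoundedGroup

variable {𝓗 : Type*} [NormedAddCommGroup 𝓗] [InnerProductSpace ℂ 𝓗] [CompleteSpace 𝓗]

/-- The unitary group `e^{-itK}` of a bounded operator `K`. -/
def expGroup (K : 𝓗 →L[ℂ] 𝓗) (t : ℝ) : 𝓗 →L[ℂ] 𝓗 := NormedSpace.exp (t • -(Complex.I • K))

theorem expGroup_zero (K : 𝓗 →L[ℂ] 𝓗) : expGroup K 0 = 1 := by
  rw [expGroup, zero_smul, NormedSpace.exp_zero]

theorem expGroup_add (K : 𝓗 →L[ℂ] 𝓗) (s t : ℝ) :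
    expGroup K (s + t) = expGroup K s * expGroup K t := by
  let _ : NormedAlgebra ℚ (𝓗 →L[ℂ] 𝓗) := NormedAlgebra.restrictScalars ℚ ℂ _
  rw [expGroup, add_smul, NormedSpace.exp_add_of_commute]
  · rfl
  · exact ((Commute.refl _).smul_left s).smul_right t

theorem expGroup_add_of_commute {K L : 𝓗 →L[ℂ] 𝓗} (h : Commute K L) (t : ℝ) :
    expGroup (K + L) t = expGroup K t * expGroup L t := by
  let _ : NormedAlgebra ℚ (𝓗 →L[ℂ] 𝓗) := NormedAlgebra.restrictScalars ℚ ℂ _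
  rw [expGroup, smul_add, neg_add, smul_add, NormedSpace.exp_add_of_commute]
  · rfl
  · exact ((((h.smul_left _).smul_right _).neg_left.neg_right).smul_left t).smul_right t

theorem hasDerivAt_expGroup (K : 𝓗 →L[ℂ] 𝓗) (t : ℝ) (ψ : 𝓗) :
    HasDerivAt (fun t => expGroup K t ψ) (expGroup K t (-(Complex.I • K ψ))) t := by
  have h := hasDerivAt_exp_smul_const (𝕂 := ℝ) (-(Complex.I • K)) t
  have h' := (((ContinuousLinearMap.apply ℂ 𝓗) ψ).restrictScalars ℝ).hasFDerivAt.comp_hasDerivAt t h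
  exact h'

theorem expGroup_mem_unitary {K : 𝓗 →L[ℂ] 𝓗} (hK : IsSelfAdjoint K) (t : ℝ) :
    expGroup K t ∈ unitary (𝓗 →L[ℂ] 𝓗) := by
  let _ : NormedAlgebra ℚ (𝓗 →L[ℂ] 𝓗) := NormedAlgebra.restrictScalars ℚ ℂ _
  have h1 : -(Complex.I • K) ∈ skewAdjoint (𝓗 →L[ℂ] 𝓗) :=
    neg_mem (hK.smul_mem_skewAdjoint Complex.conj_I)
  exact NormedSpace.exp_mem_unitary_of_mem_skewAdjoint (skewAdjoint.smul_mem t h1)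

theorem norm_expGroup {K : 𝓗 →L[ℂ] 𝓗} (hK : IsSelfAdjoint K) (t : ℝ) (ψ : 𝓗) :
    ‖expGroup K t ψ‖ = ‖ψ‖ :=
  ContinuousLinearMap.norm_map_of_mem_unitary (expGroup_mem_unitary hK t) ψ

theorem norm_expGroup_sub_le {K : 𝓗 →L[ℂ] 𝓗} (hK : IsSelfAdjoint K) (t : ℝ) (ψ : 𝓗) :
    ‖expGroup K t ψ - ψ‖ ≤ ‖K ψ‖ * |t| := by
  have h := (convex_univ (𝕜 := ℝ) (E := ℝ)).norm_image_sub_le_of_norm_hasDerivWithin_le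
    (f := fun t => expGroup K t ψ) (C := ‖K ψ‖)
    (fun s _ => (hasDerivAt_expGroup K s ψ).hasDerivWithinAt)
    (fun s _ => by rw [norm_expGroup hK, norm_neg, norm_smul, Complex.norm_I, one_mul])
    (Set.mem_univ 0) (Set.mem_univ t)
  simpa [expGroup_zero] using h

/-- Commutativity factors `e^{-itK} = e^{-itL} e^{-it(K-L)}`, which reduces the claim to
`norm_expGroup_sub_le` for `K - L`. -/
theorem norm_expGroup_sub_expGroup_le {K L : 𝓗 →L[ℂ] 𝓗} (hK : IsSelfAdjoint K)
    (hL : IsSelfAdjoint L) (h : Commute K L) (t : ℝ) (ψ : 𝓗) :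
    ‖expGroup K t ψ - expGroup L t ψ‖ ≤ ‖K ψ - L ψ‖ * |t| := by
  have h1 : expGroup K t = expGroup L t * expGroup (K - L) t := by
    rw [← expGroup_add_of_commute (h.symm.sub_right (Commute.refl L)), add_sub_cancel]
  have h2 : expGroup K t ψ - expGroup L t ψ = expGroup L t (expGroup (K - L) t ψ - ψ) := by
    rw [h1, map_sub]
    rfl
  rw [h2, norm_expGroup hL]
  exact norm_expGroup_sub_le (hK.sub hL) t ψ

end BoundedGroup

/-! ### Existence in Stone's theorem -/

section Stone

variable {𝓗 : Type*} [NormedAddCommGroup 𝓗] [InnerProductSpace ℂ 𝓗] [CompleteSpace 𝓗]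
  {H : 𝓗 →ₗ.[ℂ] 𝓗}

/-- Unitary groups of commuting bounded self-adjoint operators converging strongly to `H` on its
domain form a locally uniform Cauchy sequence. -/
theorem uniformCauchySeqOn_expGroup (hH : IsSelfAdjoint H) {K : ℕ → 𝓗 →L[ℂ] 𝓗}
    (hK : ∀ n, IsSelfAdjoint (K n)) (hcomm : ∀ m n, Commute (K m) (K n))
    (hlim : ∀ x : H.domain, Tendsto (fun n => K n x) atTop (𝓝 (H x))) (ψ : 𝓗) {T : ℝ}
    (hT : 0 < T) :
    UniformCauchySeqOn (fun n t => expGroup (K n) t ψ) atTop (Set.Ioo (-T) T) := by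
  rw [Metric.uniformCauchySeqOn_iff]
  intro η hη
  obtain ⟨x, hx, hψx⟩ := Metric.mem_closure_iff.1 (hH.dense_domain ψ) (η / 3) (by positivity)
  obtain ⟨N, hN⟩ := Metric.cauchySeq_iff.1 (hlim ⟨x, hx⟩).cauchySeq (η / (3 * T)) (by positivity)
  refine ⟨N, fun m hm n hn t ht => ?_⟩
  have hb : ∀ k, ‖expGroup (K k) t ψ - expGroup (K k) t x‖ < η / 3 := fun k => by
    rwa [← map_sub, norm_expGroup (hK k), ← dist_eq_norm]
  have hmn : ‖expGroup (K m) t x - expGroup (K n) t x‖ ≤ η / 3 := by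
    refine (norm_expGroup_sub_expGroup_le (hK m) (hK n) (hcomm m n) t x).trans ?_
    have h1 := (hN m hm n hn).le
    rw [dist_eq_norm] at h1
    calc _ ≤ η / (3 * T) * T := mul_le_mul h1 (abs_lt.2 ht).le (abs_nonneg _) (by positivity)
      _ = η / 3 := by field_simp
  rw [dist_eq_norm]
  have hsplit : expGroup (K m) t ψ - expGroup (K n) t ψ =
      (expGroup (K m) t ψ - expGroup (K m) t x) + (expGroup (K m) t x - expGroup (K n) t x) -
        (expGroup (K n) t ψ - expGroup (K n) t x) := by abel
  rw [hsplit]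
  have h3 := norm_sub_le ((expGroup (K m) t ψ - expGroup (K m) t x) +
    (expGroup (K m) t x - expGroup (K n) t x)) (expGroup (K n) t ψ - expGroup (K n) t x)
  have h4 := norm_add_le (expGroup (K m) t ψ - expGroup (K m) t x)
    (expGroup (K m) t x - expGroup (K n) t x)
  linarith [hb m, hb n]

/-- The limit `u` of the approximating groups inherits the group law and isometry. Uniform
convergence of the derivatives yields the generator on `D(H)`, and self-adjointness shows that its
domain is no larger. -/
theorem exists_isPropagator_of_approximation (hH : IsSelfAdjoint H) {K : ℕ → 𝓗 →L[ℂ] 𝓗}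
    (hK : ∀ n, IsSelfAdjoint (K n)) (hcomm : ∀ m n, Commute (K m) (K n))
    (hlim : ∀ x : H.domain, Tendsto (fun n => K n x) atTop (𝓝 (H x))) :
    ∃ U, IsPropagator H U := by
  have hcau := fun (ψ : 𝓗) (T : ℝ) (hT : 0 < T) =>
    uniformCauchySeqOn_expGroup hH hK hcomm hlim ψ hT
  have hT : ∀ t : ℝ, t ∈ Set.Ioo (-(|t| + 1)) (|t| + 1) := fun t => abs_lt.1 (lt_add_one _)
  choose u hu using fun (t : ℝ) (ψ : 𝓗) => cauchySeq_tendsto_of_complete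
    ((hcau ψ (|t| + 1) (by positivity)).cauchySeq (hT t))
  -- The argument may vary with `n`: the group law needs `y n = e^{-itK_n} ψ`, and the derivatives
  -- need `y n = -i K_n x`.
  have hunif : ∀ (y : ℕ → 𝓗) (ψ : 𝓗), Tendsto y atTop (𝓝 ψ) → ∀ T > 0,
      TendstoUniformlyOn (fun n t => expGroup (K n) t (y n)) (fun t => u t ψ) atTop
        (Set.Ioo (-T) T) := by
    intro y ψ hy T hT0
    have h1 := (hcau ψ T hT0).tendstoUniformlyOn_of_tendsto fun t _ => hu t ψ
    rw [Metric.tendstoUniformlyOn_iff] at h1 ⊢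
    intro η hη
    filter_upwards [h1 (η / 2) (half_pos hη), Metric.tendsto_nhds.1 hy (η / 2) (half_pos hη)]
      with n e1 e2 t ht
    refine (dist_triangle _ (expGroup (K n) t ψ) _).trans_lt ?_
    have e3 : dist (expGroup (K n) t ψ) (expGroup (K n) t (y n)) < η / 2 := by
      rwa [dist_eq_norm, ← map_sub, norm_expGroup (hK n), ← dist_eq_norm, dist_comm]
    linarith [e1 t ht]
  have hu' : ∀ (t : ℝ) (y : ℕ → 𝓗) (ψ : 𝓗), Tendsto y atTop (𝓝 ψ) →
      Tendsto (fun n => expGroup (K n) t (y n)) atTop (𝓝 (u t ψ)) := fun t y ψ hy =>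
    (hunif y ψ hy (|t| + 1) (by positivity)).tendsto_at (hT t)
  have hgroup : ∀ s t ψ, u (s + t) ψ = u s (u t ψ) := fun s t ψ => by
    refine tendsto_nhds_unique (hu (s + t) ψ) ((hu' s _ _ (hu t ψ)).congr fun n => ?_)
    rw [expGroup_add]
    rfl
  have hzero : ∀ ψ, u 0 ψ = ψ := fun ψ =>
    tendsto_nhds_unique (hu 0 ψ) (by simp [expGroup_zero])
  let U : ℝ → 𝓗 ≃ₗᵢ[ℂ] 𝓗 := fun t =>
    { toFun := u t
      map_add' := fun ψ φ => tendsto_nhds_unique (hu t _)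
        (((hu t ψ).add (hu t φ)).congr fun n => (map_add _ _ _).symm)
      map_smul' := fun c ψ => tendsto_nhds_unique (hu t _)
        (((hu t ψ).const_smul c).congr fun n => (map_smul _ _ _).symm)
      invFun := u (-t)
      left_inv := fun ψ => by rw [← hgroup, neg_add_cancel, hzero]
      right_inv := fun ψ => by rw [← hgroup, add_neg_cancel, hzero]
      norm_map' := fun ψ => tendsto_nhds_unique (hu t ψ).norm
        (tendsto_const_nhds.congr fun n => (norm_expGroup (hK n) t ψ).symm) }
  have hderiv : ∀ x : H.domain, HasDerivAt (fun t => U t x) (-(Complex.I • H x)) 0 := fun x => by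
    have h := hasDerivAt_of_tendstoUniformlyOn (l := atTop) (s := Set.Ioo (-1 : ℝ) 1) (x := 0)
      isOpen_Ioo (hunif _ _ ((hlim x).const_smul Complex.I).neg 1 one_pos)
      (Eventually.of_forall fun n t _ => hasDerivAt_expGroup (K n) t (x : 𝓗))
      (fun t _ => hu t x) (by simp)
    rwa [hzero] at h
  refine ⟨U, hgroup, fun ψ => ?_, fun ψ φ => ⟨fun h => ?_, ?_⟩⟩
  · refine continuous_iff_continuousAt.2 fun t => ?_
    have h := (hunif _ ψ tendsto_const_nhds (|t| + 1) (by positivity)).continuousOn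
      (Eventually.of_forall fun n => continuousOn_of_forall_continuousAt fun s _ =>
        (hasDerivAt_expGroup (K n) s ψ).continuousAt).frequently
    exact h.continuousAt (isOpen_Ioo.mem_nhds (hT t))
  · have hw : ∀ x : H.domain, inner ℂ (Complex.I • φ) (x : 𝓗) = inner ℂ ψ (H x) := by
      intro x
      have h1 : HasDerivAt (fun t : ℝ => inner ℂ (U t ψ) (x : 𝓗)) (inner ℂ φ (x : 𝓗)) 0 := by
        simpa using h.inner ℂ (hasDerivAt_const (0 : ℝ) (x : 𝓗))
      have h2 : HasDerivAt (fun t : ℝ => U (-t) x) (Complex.I • H x) 0 := by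
        have hx : HasDerivAt (fun t => U t x) (-(Complex.I • H x)) (-0) := by
          rw [neg_zero]
          exact hderiv x
        simpa [Function.comp_def] using hx.scomp (0 : ℝ) (hasDerivAt_neg (0 : ℝ))
      have h3 : HasDerivAt (fun t : ℝ => inner ℂ ψ (U (-t) x)) (inner ℂ ψ (Complex.I • H x)) 0 := by
        simpa only [inner_zero_left, add_zero] using (hasDerivAt_const (0 : ℝ) ψ).inner ℂ h2
      have h4 : (fun t : ℝ => inner ℂ (U t ψ) (x : 𝓗)) = fun t : ℝ => inner ℂ ψ (U (-t) x) := by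
        funext t
        have hx : U t (U (-t) x) = x := (U t).right_inv x
        rw [← (U t).inner_map_map ψ, hx]
      rw [h4] at h1
      have h5 := h1.unique h3
      rw [inner_smul_left, h5, inner_smul_right, Complex.conj_I, ← mul_assoc, neg_mul,
        Complex.I_mul_I, neg_neg, one_mul]
    obtain ⟨hψ, hHψ⟩ := mem_domain_of_forall_inner hH hw
    refine ⟨hψ, ?_⟩
    rw [hHψ, smul_smul, Complex.I_mul_I, neg_one_smul, neg_neg]
  · rintro ⟨hψ, rfl⟩
    exact hderiv ⟨ψ, hψ⟩

theorem IsResolvent.inner_apply_left_eq {z : ℂ} {R S : 𝓗 →L[ℂ] 𝓗} (hH : IsSelfAdjoint H)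
    (hR : IsResolvent H z R) (hS : IsResolvent H (starRingEnd ℂ z) S) (x y : 𝓗) :
    inner ℂ (R x) y = inner ℂ x (S y) := by
  have h := BallisticTransport.inner_apply_left_eq hH ⟨R x, hR.mem_domain x⟩ ⟨S y, hS.mem_domain y⟩
  rw [hR.apply_right, hS.apply_right, inner_add_left, inner_add_right, inner_smul_left,
    inner_smul_right] at h
  exact (add_right_cancel h).symm

/-- **Stone's theorem**, existence: a self-adjoint operator generates a unitary group. -/
theorem exists_isPropagator (hH : IsSelfAdjoint H) : ∃ U, IsPropagator H U := by
  have hl : ∀ n : ℕ, ((n : ℝ) + 1) ≠ 0 := fun n => by positivity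
  choose R hR hRn using fun n : ℕ => exists_isResolvent hH (hl n)
  choose S hS hSn using fun n : ℕ => exists_isResolvent hH (neg_ne_zero.2 (hl n))
  set z : ℕ → ℂ := fun n => (((n : ℝ) + 1 : ℝ) : ℂ) * Complex.I
  have hRz : ∀ n, IsResolvent H (z n) (R n) := hR
  have hSz : ∀ n, IsResolvent H (-z n) (S n) := fun n => by
    have h := hS n
    rwa [Complex.ofReal_neg, neg_mul] at h
  have hconj : ∀ n, starRingEnd ℂ (z n) = -z n := fun n => by
    rw [map_mul, Complex.conj_ofReal, Complex.conj_I, mul_neg]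
  have hsq : ∀ n, z n * z n = -((((n : ℝ) + 1) ^ 2 : ℝ) : ℂ) := fun n => by
    rw [mul_mul_mul_comm, Complex.I_mul_I]
    push_cast
    ring
  -- On `D(H)` one has `w R x = R H x - x` with `‖R‖ ≤ 1/(n+1)`; density and `‖w R‖ ≤ 1` extend the
  -- limit to all vectors.
  have happrox : ∀ {w : ℕ → ℂ} {R : ℕ → 𝓗 →L[ℂ] 𝓗}, (∀ n, IsResolvent H (w n) (R n)) →
      (∀ n, ‖w n‖ = (n : ℝ) + 1) → (∀ (n : ℕ) y, ((n : ℝ) + 1) * ‖R n y‖ ≤ ‖y‖) →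
      ∀ y, Tendsto (fun n => w n • R n y) atTop (𝓝 (-y)) := by
    intro w R hR hw hRn y
    have hbd : ∀ n v, ‖w n • R n v‖ ≤ ‖v‖ := fun n v => by
      rw [norm_smul, hw]
      exact hRn n v
    rw [Metric.tendsto_atTop]
    intro η hη
    obtain ⟨x, hx, hyx⟩ := Metric.mem_closure_iff.1 (hH.dense_domain y) (η / 4) (by positivity)
    have h0 : Tendsto (fun n => R n (H ⟨x, hx⟩)) atTop (𝓝 0) := by
      refine squeeze_zero_norm (a := fun n : ℕ => 1 / ((n : ℝ) + 1) * ‖H ⟨x, hx⟩‖) (fun n => ?_) ?_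
      · rw [one_div, ← div_eq_inv_mul, le_div_iff₀' (by positivity)]
        exact hRn n _
      · simpa using (tendsto_one_div_add_atTop_nhds_zero_nat (𝕜 := ℝ)).mul_const ‖H ⟨x, hx⟩‖
    obtain ⟨N, hN⟩ := Metric.tendsto_atTop.1 h0 (η / 4) (by positivity)
    refine ⟨N, fun n hn => ?_⟩
    have h1 := hN n hn
    rw [dist_zero_right] at h1
    rw [dist_eq_norm] at hyx ⊢
    have h2 : w n • R n y - -y = w n • R n (y - x) + R n (H ⟨x, hx⟩) + (y - x) := by
      rw [(hR n).apply_map, map_sub, smul_sub]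
      dsimp only
      abel
    rw [h2]
    have h3 := norm_add_le (w n • R n (y - x) + R n (H ⟨x, hx⟩)) (y - x)
    have h4 := norm_add_le (w n • R n (y - x)) (R n (H ⟨x, hx⟩))
    linarith [hbd n (y - x)]
  have hpos : ∀ n : ℕ, |(n : ℝ) + 1| = (n : ℝ) + 1 := fun n => abs_of_pos (by positivity)
  have hz : ∀ n, ‖z n‖ = (n : ℝ) + 1 := fun n => by
    rw [norm_mul, Complex.norm_I, mul_one, Complex.norm_real, Real.norm_eq_abs, hpos]
  have hlimR := happrox hRz hz fun n y => by rw [← hpos]; exact hRn n y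
  have hlimS := happrox hSz (fun n => by rw [norm_neg, hz]) fun n y => by
    rw [← hpos, ← abs_neg]
    exact hSn n y
  -- With `λ = n + 1` this choice is `K_n = λ² H (H² + λ²)⁻¹`, bounded and symmetric. On `D(H)` it
  -- equals `-½ (z_n R_n - z_n S_n) H`, which tends to `H` since `z_n R_n` and `-z_n S_n` both tend
  -- to `-1`.
  refine exists_isPropagator_of_approximation hH
    (K := fun n => ((((n : ℝ) + 1) ^ 2 / 2 : ℝ) : ℂ) • (R n + S n)) (fun n => ?_) (fun m n => ?_)
    fun x => ?_
  · rw [ContinuousLinearMap.isSelfAdjoint_iff_isSymmetric]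
    intro x y
    have h1 := IsResolvent.inner_apply_left_eq hH (hRz n) (by rw [hconj]; exact hSz n) x y
    have h2 := IsResolvent.inner_apply_left_eq hH (hSz n)
      (by rw [map_neg, hconj, neg_neg]; exact hRz n) x y
    simp only [ContinuousLinearMap.coe_coe, smul_apply, add_apply]
    rw [inner_smul_left, inner_smul_right, inner_add_left, inner_add_right, h1, h2,
      Complex.conj_ofReal, add_comm (inner ℂ x (S n y))]
  · exact ((((hRz m).commute (hRz n)).add_right ((hRz m).commute (hSz n))).add_left
      (((hSz m).commute (hRz n)).add_right ((hSz m).commute (hSz n)))).smul_left _ |>.smul_right _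
  · have h := ((hlimR (H x)).add (hlimS (H x))).const_smul (-(1 / 2 : ℂ))
    have hfin : -(1 / 2 : ℂ) • (-H x + -H x) = H x := by module
    rw [hfin] at h
    refine h.congr fun n => ?_
    rw [(hRz n).apply_map, (hSz n).apply_map]
    simp only [smul_apply, add_apply, smul_add, smul_smul, mul_neg, neg_mul, neg_neg, hsq]
    push_cast
    module

end Stone

section Main

theorem purePointSubspace_hamiltonianR_subset {d : ℕ} {V : EuclideanSpace ℝ (Fin d) → ℝ}
    (hH : IsSelfAdjoint (hamiltonianR d V))
    (hB : ∀ ψ : L2R d, ψ ≠ 0 → ψ ∈ (positionR d).domain → ψ ∈ (hamiltonianR d V).domain →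
      StrongBallisticTransport (hamiltonianR d V) (positionR d) ψ) :
    (purePointSubspace (hamiltonianR d V) : Set (L2R d)) ⊆
      {0} ∪ (Set.univ \ ((positionR d).domain : Set (L2R d))) :=
  purePointSubspace_subset hH (exists_isPropagator hH) (fun j => ⟨_, regularizes_hamiltonianR V j⟩)
    hB

theorem purePointSubspace_hamiltonianZ_subset {d : ℕ} {V : (Fin d → ℤ) → ℝ}
    (hH : IsSelfAdjoint (hamiltonianZ d V))
    (hB : ∀ ψ : L2Z d, ψ ≠ 0 → ψ ∈ (positionZ d).domain → ψ ∈ (hamiltonianZ d V).domain →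
      StrongBallisticTransport (hamiltonianZ d V) (positionZ d) ψ) :
    (purePointSubspace (hamiltonianZ d V) : Set (L2Z d)) ⊆
      {0} ∪ (Set.univ \ ((positionZ d).domain : Set (L2Z d))) :=
  purePointSubspace_subset hH (exists_isPropagator hH) (fun j => ⟨_, regularizes_hamiltonianZ V j⟩)
    hB

end Main

end BallisticTransport

end

open BallisticTransport in
theorem mainTheorem7 (d : ℕ) :
    (∀ V : EuclideanSpace ℝ (Fin d) → ℝ, Measurable V →
      IsSelfAdjoint (hamiltonianR d V) →
      (∀ ψ : L2R d, ψ ≠ 0 → ψ ∈ (positionR d).domain → ψ ∈ (hamiltonianR d V).domain →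
        StrongBallisticTransport (hamiltonianR d V) (positionR d) ψ) →
      (purePointSubspace (hamiltonianR d V) : Set (L2R d)) ⊆
        {0} ∪ (Set.univ \ ((positionR d).domain : Set (L2R d)))) ∧
    (∀ V : (Fin d → ℤ) → ℝ,
      IsSelfAdjoint (hamiltonianZ d V) →
      (∀ ψ : L2Z d, ψ ≠ 0 → ψ ∈ (positionZ d).domain → ψ ∈ (hamiltonianZ d V).domain →
        StrongBallisticTransport (hamiltonianZ d V) (positionZ d) ψ) →
      (purePointSubspace (hamiltonianZ d V) : Set (L2Z d)) ⊆
        {0} ∪ (Set.univ \ ((positionZ d).domain : Set (L2Z d)))) := by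
  exact ⟨fun _ _ hH hB => purePointSubspace_hamiltonianR_subset hH hB,
    fun _ hH hB => purePointSubspace_hamiltonianZ_subset hH hB⟩
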